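/- Let $(W,S)$ be a Coxeter system with $W$ finite, and let $T=\{wsw^{-1} : w\in W,\ s\in S\}$ be its set of reflections. Let $W$ act faithfully and orthogonally on a finite-dimensional Euclidean space $V$ such that each $s\in S$ acts as the reflection $s_{\alpha_s}$ in the hyperplane $\alpha_s^{\perp}$ for some $0\neq\alpha_s\in V$, the vectors $\alpha_s$ span $V$, and $\Phi=\{w(\alpha_s) : w\in W,\ s\in S\}$ is a crystallographic root system in $V$ (that is, $\Phi$ is a finite set of nonzero vectors spanning $V$ with $s_\alpha(\Phi)=\Phi$ and $\Phi\cap\mathbb{R}\alpha=\{\pm\alpha\}$ for all $\alpha\in\Phi$, and $2(\alpha\mid\beta)/(\alpha\mid\alpha)\in\mathbb{Z}$ for all $\alpha,\beta\in\Phi$). Thus $W$ is the Weyl group of $\Phi$, and the elements of $T$ act as the reflections $s_\alpha$, $\alpha\in\Phi$. For $R\subseteq\Phi$ let $R^\vee=\{2\alpha/(\alpha\mid\alpha) : \alpha\in R\}$ and let $L(R)$ be the $\mathbb{Z}$-span of $R$. Let $X\subseteq T$. (a) Let $R\subseteq\Phi$ be a set of roots such that $X$ is exactly the set of elements of $W$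 acting as $s_\alpha$ with $\alpha\in R$. Then $X$ generates $W$ if and only if $L(R)=L(\Phi)$ (the root lattice) and $L(R^\vee)=L(\Phi^\vee)$ (the coroot lattice). (b) Let $R\subseteq\Phi$ consist of exactly one root for each reflection in $X$, and suppose that $X$ generates $W$. Then $X$ is minimal with respect to inclusion among the subsets of $T$ that generate $W$ if and only if $R$ is a $\mathbb{Z}$-basis of $L(\Phi)$ and $R^\vee$ is a $\mathbb{Z}$-basis of $L(\Phi^\vee)$. -/

import Mathlib

namespace ReflectionGeneration

open scoped InnerProductSpace

section RootSystems

variable {V : Type*} [NormedAddCommGroup V] [InnerProductSpace ℝ V]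

/-- The orthogonal reflection `s_α`, fixing the hyperplane `α^⊥` pointwise and sending
`α` to `-α`. -/
noncomputable def rootReflection (α : V) : V ≃ₗᵢ[ℝ] V :=
  (Submodule.span ℝ {α})ᗮ.reflection

/-- The usual formula `s_α(v) = v - (2(α|v)/(α|α)) α`. -/
theorem rootReflection_apply (α v : V) :
    rootReflection α v = v - (2 * ⟪α, v⟫_ℝ / ⟪α, α⟫_ℝ) • α := by
  rw [rootReflection, Submodule.reflection_orthogonal_apply, Submodule.reflection_singleton_apply,
    real_inner_self_eq_norm_sq, two_nsmul, neg_sub, ← add_smul, ← two_mul, mul_div_assoc]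
  rfl

/-- Root systems in the Euclidean space `V`: finite sets of nonzero vectors spanning `V`, stable
under the reflections in their elements, with `Φ ∩ ℝα = {α, -α}` for all `α ∈ Φ`. -/
structure IsRootSystem (Φ : Set V) : Prop where
  finite : Φ.Finite
  zero_notMem : (0 : V) ∉ Φ
  span_eq_top : Submodule.span ℝ Φ = ⊤
  reflection_image : ∀ α ∈ Φ, rootReflection α '' Φ = Φ
  reduced : ∀ α ∈ Φ, Φ ∩ (Submodule.span ℝ {α} : Submodule ℝ V) = {α, -α}

/-- The numbers `2(α|β)/(α|α)` are integers. -/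
def IsCrystallographic (Φ : Set V) : Prop :=
  ∀ α ∈ Φ, ∀ β ∈ Φ, ∃ n : ℤ, 2 * ⟪α, β⟫_ℝ / ⟪α, α⟫_ℝ = n

/-- The coroot `α^∨ = 2α/(α|α)`. -/
noncomputable def coroot (α : V) : V := (2 / ⟪α, α⟫_ℝ) • α

/-- The set of coroots `R^∨`. -/
def coroots (R : Set V) : Set V := coroot '' R

/-- `L(R)`, the `ℤ`-span of a set of vectors. For a root system `Φ`, `latticeSpan Φ` is the root
lattice and `latticeSpan (coroots Φ)` is the coroot lattice. -/
def latticeSpan (R : Set V) : Submodule ℤ V := Submodule.span ℤ R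

/-- `R` is a `ℤ`-basis of the lattice `L`. -/
def IsLatticeBasis (R : Set V) (L : Submodule ℤ V) : Prop :=
  LinearIndepOn ℤ id R ∧ Submodule.span ℤ R = L

end RootSystems

section CoxeterGroups

variable {B W : Type*} [Group W] {M : CoxeterMatrix B}

/-- A faithful orthogonal representation of the Coxeter system `(W, S)` on the Euclidean space `V`
in which the simple generators `s ∈ S` act as reflections `s_{α_s}`, with the `α_s`
spanning `V`. -/
structure GeometricRepresentation (cs : CoxeterSystem M W) (V : Type*) [NormedAddCommGroup V]
    [InnerProductSpace ℝ V] [FiniteDimensional ℝ V] where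
  toHom : W →* (V ≃ₗᵢ[ℝ] V)
  injective : Function.Injective toHom
  simpleRoot : B → V
  simpleRoot_ne_zero : ∀ i, simpleRoot i ≠ 0
  map_simple : ∀ i, toHom (cs.simple i) = rootReflection (simpleRoot i)
  span_simpleRoot : Submodule.span ℝ (Set.range simpleRoot) = ⊤

variable {cs : CoxeterSystem M W} {V : Type*} [NormedAddCommGroup V] [InnerProductSpace ℝ V]
  [FiniteDimensional ℝ V]

/-- `Φ = {w(α_s) | s ∈ S, w ∈ W}`. -/
def GeometricRepresentation.roots (ρ : GeometricRepresentation cs V) : Set V :=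
  {β | ∃ (w : W) (i : B), β = ρ.toHom w (ρ.simpleRoot i)}

/-- `R` is a set of roots whose associated reflections are exactly the elements of `X`. (Both
choices `±α` of a root for an element of `X` are allowed in `R`.) -/
def GeometricRepresentation.IsRootSetOf (ρ : GeometricRepresentation cs V) (R : Set V)
    (X : Set W) : Prop :=
  R ⊆ ρ.roots ∧ rootReflection '' R = ρ.toHom '' X

/-- `R` consists of exactly one root for each reflection in `X`. -/
def GeometricRepresentation.IsRootTransversalOf (ρ : GeometricRepresentation cs V) (R : Set V)
    (X : Set W) : Prop :=
  ρ.IsRootSetOf R X ∧ Set.InjOn rootReflection R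

/-- The set `T` of reflections of `(W, S)`. -/
def reflections (cs : CoxeterSystem M W) : Set W := {t | cs.IsReflection t}

/-- `X` is a subset of `T` generating `W`. -/
def IsGeneratingReflectionSet (cs : CoxeterSystem M W) (X : Set W) : Prop :=
  X ⊆ reflections cs ∧ Subgroup.closure X = ⊤

end CoxeterGroups

end ReflectionGeneration

/-! Everything passes through `GeneratedRoot R`, the roots obtained from R by repeatedly reflecting
in members of R. Sign characters show that a generating set of reflections meets every conjugacy
class of reflections; hence X generates W exactly when R generates every root
(`closure_eq_top_iff`).

For (a), reflecting never leaves the lattices spanned by R and by its coroots, so generation forces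
both equalities. Conversely, R may be replaced by a linearly independent set D generating the same
roots (`exists_base`). Over D the coordinates n_i of a root β and m_i of its coroot satisfy
n_i(δ_i|δ_i) = m_i(β|β), and this is enough for a descent by reflections from β to D
(`generatedRoot_of_integral`).

For (b), minimality of X means that no root of R is generated by the others, and the crux is that
such an R is independent. A smallest counterexample is a circuit, with a positive relation after
sign changes. While two members form an acute angle, reflecting one in the other enlarges
`minRelationSum`; as there are finitely many families, an obtuse circuit is reached. Its roots lift
to integer coordinate vectors that behave like affine real roots, the relation c playing the
imaginary root. Moving a functional into the dominant chamber then exhibits a member generated by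
the others (`exists_generatedRoot_of_obtuse`), a contradiction. -/

namespace ReflectionGeneration

open scoped InnerProductSpace

/-! ### Roots generated by reflections, Cartan integers, and the integral descent -/

section GeneratedRoots

variable {V : Type*} [NormedAddCommGroup V] [InnerProductSpace ℝ V]

/-- The smallest set of vectors containing `D` and stable under the reflections in the elements
of `D`. -/
inductive GeneratedRoot (D : Set V) : V → Prop
  | of_mem {δ : V} (hδ : δ ∈ D) : GeneratedRoot D δ
  | reflection {δ γ : V} (hδ : δ ∈ D) (hγ : GeneratedRoot D γ) :
      GeneratedRoot D (rootReflection δ γ)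

theorem rootReflection_rootReflection_self (α v : V) :
    rootReflection α (rootReflection α v) = v :=
  Submodule.reflection_reflection _ v

theorem rootReflection_self (α : V) : rootReflection α α = -α :=
  Submodule.reflection_mem_subspace_orthogonal_precomplement_eq_neg
    (Submodule.mem_span_singleton_self α)

theorem rootReflection_map (g : V ≃ₗᵢ[ℝ] V) (α v : V) :
    rootReflection (g α) v = g (rootReflection α (g.symm v)) := by
  have h : ⟪g α, v⟫_ℝ = ⟪α, g.symm v⟫_ℝ := by
    rw [← g.inner_map_map α (g.symm v), g.apply_symm_apply]
  rw [rootReflection_apply, rootReflection_apply, h, g.inner_map_map]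
  simp

theorem inner_rootReflection_self (α v : V) :
    ⟪rootReflection α v, rootReflection α v⟫_ℝ = ⟪v, v⟫_ℝ :=
  (rootReflection α).inner_map_map v v

namespace GeneratedRoot

variable {D E : Set V}

theorem neg {γ : V} (h : GeneratedRoot D γ) : GeneratedRoot D (-γ) := by
  induction h with
  | of_mem hδ => exact rootReflection_self (V := V) _ ▸ .reflection hδ (.of_mem hδ)
  | reflection hδ _ ih => rw [← map_neg]; exact .reflection hδ ih

/-- Reflecting in a generated root is allowed too, because the reflection in s_δ(γ) is s_δ s_γ s_δ.
-/
theorem reflection' {γ η : V} (hγ : GeneratedRoot D γ) (hη : GeneratedRoot D η) :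
    GeneratedRoot D (rootReflection γ η) := by
  induction hγ generalizing η with
  | of_mem hδ => exact .reflection hδ hη
  | @reflection δ γ hδ _ ih =>
    rw [rootReflection_map]
    refine .reflection hδ (ih ?_)
    have : (rootReflection δ).symm η = rootReflection δ η :=
      (LinearIsometryEquiv.symm_apply_eq _).2 (rootReflection_rootReflection_self δ η).symm
    rw [this]
    exact .reflection hδ hη

theorem of_reflection {γ η : V} (hγ : GeneratedRoot D γ)
    (hη : GeneratedRoot D (rootReflection γ η)) : GeneratedRoot D η := by
  rw [← rootReflection_rootReflection_self γ η]
  exact hγ.reflection' hη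

theorem trans {γ : V} (h : GeneratedRoot D γ) (hDE : ∀ δ ∈ D, GeneratedRoot E δ) :
    GeneratedRoot E γ := by
  induction h with
  | of_mem hδ => exact hDE _ hδ
  | reflection hδ _ ih => exact (hDE _ hδ).reflection' ih

theorem mono {γ : V} (h : GeneratedRoot D γ) (hDE : D ⊆ E) : GeneratedRoot E γ :=
  h.trans fun _ hδ ↦ .of_mem (hDE hδ)

end GeneratedRoot

theorem rootReflection_eq_sub {α β : V} (hα : α ≠ 0) {p : ℝ} (hp : 2 * ⟪α, β⟫_ℝ = p * ⟪α, α⟫_ℝ) :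
    rootReflection α β = β - p • α := by
  rw [rootReflection_apply, hp, mul_div_cancel_right₀ _ (inner_self_ne_zero.2 hα)]

variable {Φ : Set V}

namespace IsRootSystem

theorem ne_zero (hΦ : IsRootSystem Φ) {α : V} (hα : α ∈ Φ) : α ≠ 0 :=
  fun h ↦ hΦ.zero_notMem (h ▸ hα)

theorem inner_self_pos (hΦ : IsRootSystem Φ) {α : V} (hα : α ∈ Φ) : 0 < ⟪α, α⟫_ℝ :=
  real_inner_self_pos.2 (hΦ.ne_zero hα)

theorem reflection_mem (hΦ : IsRootSystem Φ) {α β : V} (hα : α ∈ Φ) (hβ : β ∈ Φ) :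
    rootReflection α β ∈ Φ :=
  hΦ.reflection_image α hα ▸ Set.mem_image_of_mem _ hβ

theorem neg_mem (hΦ : IsRootSystem Φ) {α : V} (hα : α ∈ Φ) : -α ∈ Φ :=
  rootReflection_self α ▸ hΦ.reflection_mem hα hα

theorem mem_of_generatedRoot (hΦ : IsRootSystem Φ) {D : Set V} (hD : D ⊆ Φ) {γ : V}
    (h : GeneratedRoot D γ) : γ ∈ Φ := by
  induction h with
  | of_mem hδ => exact hD hδ
  | reflection hδ _ ih => exact hΦ.reflection_mem (hD hδ) ih

theorem eq_or_eq_neg_of_smul (hΦ : IsRootSystem Φ) {α β : V} (hα : α ∈ Φ) (hβ : β ∈ Φ) {c : ℝ}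
    (h : β = c • α) : β = α ∨ β = -α := by
  have : β ∈ Φ ∩ (Submodule.span ℝ {α} : Submodule ℝ V) :=
    ⟨hβ, Submodule.mem_span_singleton.2 ⟨c, h.symm⟩⟩
  rw [hΦ.reduced α hα] at this
  simpa using this

theorem eq_or_eq_neg_of_rootReflection_eq (hΦ : IsRootSystem Φ) {α β : V} (hα : α ∈ Φ)
    (hβ : β ∈ Φ) (h : rootReflection α = rootReflection β) : β = α ∨ β = -α := by
  have h1 := rootReflection_apply α β
  rw [h, rootReflection_self] at h1
  refine hΦ.eq_or_eq_neg_of_smul hα hβ (c := (1 / 2) * (2 * ⟪α, β⟫_ℝ / ⟪α, α⟫_ℝ)) ?_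
  have h2 : (2 : ℝ) • β = (2 * ⟪α, β⟫_ℝ / ⟪α, α⟫_ℝ) • α := by
    rw [two_smul]
    nth_rewrite 1 [← neg_neg β]
    rw [h1]
    abel
  rw [mul_smul, ← h2, smul_smul]
  norm_num

/-- The two Cartan integers of a pair of roots; their product is less than four unless the roots
are proportional. -/
theorem exists_cartan_integers (hΦ : IsRootSystem Φ) (hc : IsCrystallographic Φ) {α β : V}
    (hα : α ∈ Φ) (hβ : β ∈ Φ) :
    ∃ p q : ℤ, 2 * ⟪α, β⟫_ℝ = p * ⟪α, α⟫_ℝ ∧ 2 * ⟪α, β⟫_ℝ = q * ⟪β, β⟫_ℝ ∧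
      (⟪α, β⟫_ℝ ≠ 0 → 0 < p * q) ∧ (β ≠ α → β ≠ -α → p * q < 4) := by
  have ha := hΦ.inner_self_pos hα
  have hb := hΦ.inner_self_pos hβ
  obtain ⟨p, hp⟩ := hc α hα β hβ
  obtain ⟨q, hq⟩ := hc β hβ α hα
  rw [div_eq_iff ha.ne'] at hp
  rw [div_eq_iff hb.ne', real_inner_comm] at hq
  have h4 : ((p * q : ℤ) : ℝ) * (⟪α, α⟫_ℝ * ⟪β, β⟫_ℝ) = 4 * (⟪α, β⟫_ℝ * ⟪α, β⟫_ℝ) := by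
    push_cast
    calc (p : ℝ) * q * (⟪α, α⟫_ℝ * ⟪β, β⟫_ℝ) = (p * ⟪α, α⟫_ℝ) * (q * ⟪β, β⟫_ℝ) := by ring
      _ = _ := by rw [← hp, ← hq]; ring
  refine ⟨p, q, hp, hq, fun h0 ↦ ?_, fun h1 h2 ↦ ?_⟩
  · have := mul_self_pos.2 h0
    have h5 : (0 : ℝ) < ((p * q : ℤ) : ℝ) * (⟪α, α⟫_ℝ * ⟪β, β⟫_ℝ) := by rw [h4]; positivity
    exact_mod_cast (pos_iff_pos_of_mul_pos h5).2 (mul_pos ha hb)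
  have hlt : ⟪α, β⟫_ℝ * ⟪α, β⟫_ℝ < ⟪α, α⟫_ℝ * ⟪β, β⟫_ℝ := by
    have key : 0 < ⟪β - (⟪α, β⟫_ℝ / ⟪α, α⟫_ℝ) • α, β - (⟪α, β⟫_ℝ / ⟪α, α⟫_ℝ) • α⟫_ℝ := by
      refine real_inner_self_pos.2 fun h ↦ ?_
      rcases hΦ.eq_or_eq_neg_of_smul hα hβ (sub_eq_zero.1 h) with h | h
      exacts [h1 h, h2 h]
    rw [inner_sub_left, inner_sub_right, inner_sub_right, real_inner_smul_left,
      real_inner_smul_left, real_inner_smul_right, real_inner_smul_right,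
      real_inner_comm α β] at key
    have : ⟪α, β⟫_ℝ / ⟪α, α⟫_ℝ * ⟪α, α⟫_ℝ = ⟪α, β⟫_ℝ := div_mul_cancel₀ _ ha.ne'
    have h3 := mul_pos ha key
    nlinarith [h3, this]
  have h5 : ((p * q : ℤ) : ℝ) < 4 := by
    refine lt_of_mul_lt_mul_right ?_ (mul_pos ha hb).le
    rw [h4]
    linarith
  exact_mod_cast h5

end IsRootSystem

/-- If |n - p| ≥ |n|, then |p| ≥ 2|n| since n and p have the same sign; the proportion m : n = q : p
gives |q| ≥ 2|m|. As n and m are nonzero integers, pq ≥ 4 follows, which is excluded. -/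
theorem natAbs_sub_lt_of_cartan {n m p q : ℤ} (hnp : 0 < n * p) (hmq : m * p = n * q)
    (hpq : p * q < 4) (hpq0 : 0 < p * q) : (n - p).natAbs < n.natAbs := by
  have hn : n ≠ 0 := by rintro rfl; simp at hnp
  have hp : p ≠ 0 := by rintro rfl; simp at hnp
  by_contra hcon
  have h1 : |n| ≤ |n - p| := by
    rw [Int.abs_eq_natAbs, Int.abs_eq_natAbs]
    exact_mod_cast not_lt.1 hcon
  have h2 : 2 * (n * p) ≤ p * p := by
    have := sq_le_sq.2 h1
    nlinarith
  rcases lt_or_gt_of_ne hp with hp0 | hp0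
  · have hq : q < 0 := by nlinarith
    have hn0 : n < 0 := by nlinarith
    have h3 : p ≤ 2 * n := by nlinarith
    have hm : m < 0 := by nlinarith [mul_pos_of_neg_of_neg hn0 hq]
    have h4 : q ≤ 2 * m := by nlinarith
    nlinarith
  · have hq : 0 < q := by nlinarith
    have hn0 : 0 < n := by nlinarith
    have h3 : 2 * n ≤ p := by nlinarith
    have hm : 0 < m := by nlinarith [mul_pos hn0 hq]
    have h4 : 2 * m ≤ q := by nlinarith
    nlinarith

/-- A root which is an integral combination of the roots `δ i`, and whose coroot is the
corresponding integral combination of their coroots, is obtained from them by reflections. -/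
theorem generatedRoot_of_integral (hΦ : IsRootSystem Φ) (hc : IsCrystallographic Φ) {ι : Type*}
    [Fintype ι] {δ : ι → V} (hδ : ∀ i, δ i ∈ Φ) {S : Set V} {β : V} (hβ : β ∈ Φ) {n m : ι → ℤ}
    (hn : β = ∑ i, (n i : ℝ) • δ i) (hm : ∀ i, n i * ⟪δ i, δ i⟫_ℝ = m i * ⟪β, β⟫_ℝ)
    (hS : ∀ i, n i ≠ 0 → δ i ∈ S) : GeneratedRoot S β := by
  classical
  induction hN : ∑ i, (n i).natAbs using Nat.strong_induction_on generalizing β n m with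
  | _ N ih =>
  have hβ0 := hΦ.inner_self_pos hβ
  -- Some term of (β|β) = ∑ n_i(δ_i|β) is positive; reflecting in that δ_j changes only n_j to n_j -
  -- p and m_j to m_j - q, and lowers ∑|n_i|.
  obtain ⟨j, hj⟩ : ∃ j, 0 < n j * ⟪δ j, β⟫_ℝ := by
    by_contra! hcon
    have : ⟪β, β⟫_ℝ = ∑ i, n i * ⟪δ i, β⟫_ℝ := by
      nth_rewrite 1 [hn]
      simp [sum_inner, real_inner_smul_left]
    exact hβ0.not_ge (this ▸ Finset.sum_nonpos fun i _ ↦ hcon i)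
  have hnj : n j ≠ 0 := fun h ↦ by simp [h] at hj
  have hjS := hS j hnj
  have hj0 := hΦ.inner_self_pos (hδ j)
  obtain ⟨p, q, hp, hq, hpos, hpq⟩ := hΦ.exists_cartan_integers hc (hδ j) hβ
  by_cases h1 : β = δ j
  · exact h1 ▸ .of_mem hjS
  by_cases h2 : β = -δ j
  · exact h2 ▸ (GeneratedRoot.of_mem hjS).neg
  have hnp : 0 < n j * p := by
    have : 0 < ((n j * p : ℤ) : ℝ) * ⟪δ j, δ j⟫_ℝ := by
      push_cast
      rw [mul_assoc, ← hp]
      linarith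
    exact_mod_cast (pos_iff_pos_of_mul_pos this).2 hj0
  have hmq : m j * p = n j * q := by
    have : ((m j * p : ℤ) : ℝ) * ⟪β, β⟫_ℝ = ((n j * q : ℤ) : ℝ) * ⟪β, β⟫_ℝ := by
      push_cast
      calc (m j : ℝ) * p * ⟪β, β⟫_ℝ = p * (m j * ⟪β, β⟫_ℝ) := by ring
        _ = n j * (p * ⟪δ j, δ j⟫_ℝ) := by rw [← hm]; ring
        _ = n j * q * ⟪β, β⟫_ℝ := by rw [← hp, hq]; ring
    exact_mod_cast mul_right_cancel₀ hβ0.ne' this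
  have hpq0 : 0 < p * q := hpos (by rintro h; simp [h] at hj)
  have hlt := natAbs_sub_lt_of_cartan hnp hmq (hpq h1 h2) hpq0
  have hrefl := rootReflection_eq_sub (hΦ.ne_zero (hδ j)) hp
  refine (GeneratedRoot.of_mem hjS).of_reflection ?_
  refine @ih (∑ i, (n i - if i = j then p else 0).natAbs) ?_ _ (hΦ.reflection_mem (hδ j) hβ)
    (fun i ↦ n i - if i = j then p else 0) (fun i ↦ m i - if i = j then q else 0) ?_ ?_ ?_ rfl
  · rw [← hN]
    refine Finset.sum_lt_sum (fun i _ ↦ ?_) ⟨j, Finset.mem_univ j, by simpa using hlt⟩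
    split_ifs with h
    · exact h ▸ hlt.le
    · simp
  · rw [hrefl]
    nth_rewrite 1 [hn]
    simp [sub_smul, Finset.sum_sub_distrib, ite_smul]
  · intro i
    rw [inner_rootReflection_self]
    push_cast
    rw [sub_mul, sub_mul, hm]
    split_ifs with h
    · rw [h, ← hp, hq]
    · simp
  · intro i hi
    by_cases h : i = j
    · exact h ▸ hjS
    · exact hS i (by simpa [h] using hi)

/-- Pairwise obtuse vectors lying in an open half-space are linearly independent. -/
theorem linearIndependent_of_obtuse {ι : Type*} {v : ι → V} (f : Module.Dual ℝ V)
    (hf : ∀ i, 0 < f (v i)) (hv : ∀ i j, i ≠ j → ⟪v i, v j⟫_ℝ ≤ 0) :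
    LinearIndependent ℝ v := by
  classical
  rw [linearIndependent_iff']
  intro s g hg
  have hnn : ∀ g : ι → ℝ, ∑ i ∈ s, g i • v i = 0 → ∀ i ∈ s, g i ≤ 0 := by
    intro g hg
    have hw : ∑ i ∈ s, (g i)⁺ • v i = ∑ i ∈ s, (g i)⁻ • v i := by
      rw [← sub_eq_zero, ← Finset.sum_sub_distrib, ← hg]
      refine Finset.sum_congr rfl fun i _ ↦ ?_
      rw [← sub_smul, posPart_sub_negPart]
    -- The positive and negative parts give the same vector and have disjoint supports, so its
    -- square norm is a sum of nonpositive terms.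
    have h0 : ∑ i ∈ s, (g i)⁺ • v i = 0 := by
      refine real_inner_self_nonpos.1 ?_
      nth_rewrite 2 [hw]
      simp only [sum_inner, inner_sum, real_inner_smul_left, real_inner_smul_right]
      refine Finset.sum_nonpos fun i _ ↦ Finset.sum_nonpos fun j _ ↦ ?_
      by_cases hij : i = j
      · subst hij
        rcases le_total (g i) 0 with h | h
        · simp [posPart_eq_zero.2 h]
        · simp [negPart_eq_zero.2 h]
      · exact mul_nonpos_of_nonneg_of_nonpos (negPart_nonneg _)
          (mul_nonpos_of_nonneg_of_nonpos (posPart_nonneg _) (hv _ _ (by tauto)))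
    have h1 : ∑ i ∈ s, (g i)⁺ * f (v i) = 0 := by
      simpa using congrArg f h0
    intro i hi
    have := (Finset.sum_eq_zero_iff_of_nonneg
      (fun i _ ↦ mul_nonneg (posPart_nonneg (g i)) (hf i).le)).1 h1 i hi
    exact posPart_eq_zero.1 ((mul_eq_zero.1 this).resolve_right (hf i).ne')
  intro i hi
  refine le_antisymm (hnn g hg i hi) ?_
  have := hnn (-g) (by simpa using hg) i hi
  simpa using this

end GeneratedRoots

/-! ### Independent generating sets and the two-lattice criterion -/

section Lattices

variable {V : Type*} [NormedAddCommGroup V] [InnerProductSpace ℝ V] {Φ : Set V}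

theorem GeneratedRoot.mem_latticeSpan (hΦ : IsRootSystem Φ) (hc : IsCrystallographic Φ)
    {D : Set V} (hD : D ⊆ Φ) {γ : V} (h : GeneratedRoot D γ) : γ ∈ latticeSpan D := by
  induction h with
  | of_mem hδ => exact Submodule.subset_span hδ
  | @reflection δ γ hδ hγ ih =>
    obtain ⟨p, -, hp, -⟩ :=
      hΦ.exists_cartan_integers hc (hD hδ) (hΦ.mem_of_generatedRoot hD hγ)
    rw [rootReflection_eq_sub (hΦ.ne_zero (hD hδ)) hp, Int.cast_smul_eq_zsmul]
    exact sub_mem ih (Submodule.smul_mem _ _ (Submodule.subset_span hδ))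

theorem GeneratedRoot.coroot_mem_latticeSpan (hΦ : IsRootSystem Φ) (hc : IsCrystallographic Φ)
    {D : Set V} (hD : D ⊆ Φ) {γ : V} (h : GeneratedRoot D γ) :
    coroot γ ∈ latticeSpan (coroots D) := by
  induction h with
  | of_mem hδ => exact Submodule.subset_span (Set.mem_image_of_mem _ hδ)
  | @reflection δ γ hδ hγ ih =>
    have hγΦ := hΦ.mem_of_generatedRoot hD hγ
    obtain ⟨p, q, hp, hq, -⟩ := hΦ.exists_cartan_integers hc (hD hδ) hγΦ
    have h1 : coroot (rootReflection δ γ) = coroot γ - q • coroot δ := by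
      have hd := (hΦ.inner_self_pos (hD hδ)).ne'
      have hg := (hΦ.inner_self_pos hγΦ).ne'
      rw [coroot, inner_rootReflection_self, rootReflection_eq_sub (hΦ.ne_zero (hD hδ)) hp,
        smul_sub, coroot, coroot, ← Int.cast_smul_eq_zsmul ℝ, smul_smul, smul_smul]
      congr 2
      rw [div_mul_eq_mul_div, mul_div_assoc', div_eq_div_iff hg hd]
      linear_combination 2 * (hq - hp)
    rw [h1]
    exact sub_mem ih (Submodule.smul_mem _ _ (Submodule.subset_span (Set.mem_image_of_mem _ hδ)))

/-- Every set of roots generates the same roots as some linearly independent set of roots. -/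
theorem IsRootSystem.exists_base (hΦ : IsRootSystem Φ) (hc : IsCrystallographic Φ) {R : Set V}
    (hR : R ⊆ Φ) :
    ∃ D : Finset V, (D : Set V) ⊆ Φ ∧ LinearIndependent ℝ (fun δ : D ↦ (δ : V)) ∧
      (∀ δ ∈ D, GeneratedRoot R δ) ∧ ∀ α ∈ R, GeneratedRoot (D : Set V) α := by
  classical
  have : Finite Φ := hΦ.finite
  obtain ⟨f, hf⟩ := Module.exists_dual_forall_apply_ne_zero (K := ℝ) (fun α : Φ ↦ (α : V))
    fun α ↦ hΦ.ne_zero α.2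
  replace hf : ∀ α ∈ Φ, f α ≠ 0 := fun α hα ↦ hf ⟨α, hα⟩
  -- Candidates are sets of f-positive roots generating the same roots as R; one of least total
  -- f-value will turn out to be pairwise obtuse.
  let A : Set (Finset V) := {D | (∀ δ ∈ D, δ ∈ Φ ∧ 0 < f δ ∧ GeneratedRoot R δ) ∧
    ∀ α ∈ R, GeneratedRoot (D : Set V) α}
  have hA : A.Finite := by
    refine (hΦ.finite.toFinset.powerset.finite_toSet).subset fun D hD ↦ ?_
    simp only [Finset.coe_powerset, Set.mem_preimage, Set.mem_powerset_iff, Set.Finite.coe_toFinset]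
    exact fun δ hδ ↦ (hD.1 δ hδ).1
  have hA0 : A.Nonempty := by
    refine ⟨hΦ.finite.toFinset.filter fun δ ↦ 0 < f δ ∧ GeneratedRoot R δ, ?_, fun α hα ↦ ?_⟩
    · simp
    · rcases lt_or_gt_of_ne (hf α (hR hα)) with h | h
      · rw [← neg_neg α]
        exact (GeneratedRoot.of_mem (Finset.mem_coe.2 (Finset.mem_filter.2
          ⟨hΦ.finite.mem_toFinset.2 (hΦ.neg_mem (hR hα)), by simpa using h,
            (GeneratedRoot.of_mem hα).neg⟩))).neg
      · exact .of_mem (Finset.mem_coe.2 (Finset.mem_filter.2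
          ⟨hΦ.finite.mem_toFinset.2 (hR hα), h, .of_mem hα⟩))
  obtain ⟨D, hD, hmin⟩ := Set.exists_min_image A (fun D ↦ ∑ δ ∈ D, f δ) hA hA0
  -- Otherwise replacing δ by whichever of ±s_γ(δ) is f-positive would lower the total. Applied both
  -- ways to an acute pair, this forces the product of its Cartan integers to be at least 4.
  have key : ∀ δ ∈ D, ∀ γ ∈ D, δ ≠ γ → ∀ p : ℤ, 2 * ⟪γ, δ⟫_ℝ = p * ⟪γ, γ⟫_ℝ → 0 < p →
      2 * f δ ≤ p * f γ := by
    intro δ hδ γ hγ hne p hp hp0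
    by_contra! hlt
    have hγ0 := hΦ.ne_zero (hD.1 γ hγ).1
    have hmem := hΦ.reflection_mem (hD.1 γ hγ).1 (hD.1 δ hδ).1
    have hgen := (hD.1 γ hγ).2.2.reflection' (hD.1 δ hδ).2.2
    obtain ⟨η, hη, hη1, hη2⟩ : ∃ η, (η = rootReflection γ δ ∨ η = -rootReflection γ δ) ∧
        0 < f η ∧ f η < f δ := by
      have h1 : f (rootReflection γ δ) = f δ - p * f γ := by
        rw [rootReflection_eq_sub hγ0 hp]
        simp
      have h2 : 0 < p * f γ := mul_pos (by exact_mod_cast hp0) (hD.1 γ hγ).2.1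
      rcases lt_or_gt_of_ne (hf _ hmem) with h | h
      · exact ⟨_, .inr rfl, by simpa using h, by rw [map_neg, h1]; linarith⟩
      · exact ⟨_, .inl rfl, h, by rw [h1]; linarith⟩
    have hηΦ : η ∈ Φ := by
      rcases hη with rfl | rfl
      exacts [hmem, hΦ.neg_mem hmem]
    have hηR : GeneratedRoot R η := by
      rcases hη with rfl | rfl
      exacts [hgen, hgen.neg]
    have hγ' : GeneratedRoot (insert η (D.erase δ) : Finset V) γ :=
      .of_mem (by simp [hγ, hne.symm])
    have hδ' : GeneratedRoot (insert η (D.erase δ) : Finset V) δ := by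
      refine hγ'.of_reflection ?_
      have h3 : GeneratedRoot (insert η (D.erase δ) : Finset V) η := .of_mem (by simp)
      rcases hη with h | h
      · exact h ▸ h3
      · rw [← neg_neg (rootReflection γ δ), ← h]
        exact h3.neg
    have hnew : insert η (D.erase δ) ∈ A := by
      refine ⟨fun ε hε ↦ ?_, fun α hα ↦ (hD.2 α hα).trans fun ε hε ↦ ?_⟩
      · rcases Finset.mem_insert.1 hε with rfl | hε
        · exact ⟨hηΦ, hη1, hηR⟩
        · exact hD.1 ε (Finset.mem_of_mem_erase hε)
      · by_cases h : ε = δ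
        · exact h ▸ hδ'
        · refine .of_mem ?_
          have : ε ∈ D := hε
          simp [h, this]
    have hle := hmin _ hnew
    -- Only an inequality, since η may already belong to D.
    have hsum : ∑ ε ∈ insert η (D.erase δ), f ε ≤ f η + ∑ ε ∈ D.erase δ, f ε := by
      by_cases h : η ∈ D.erase δ
      · rw [Finset.insert_eq_of_mem h]
        linarith
      · rw [Finset.sum_insert h]
    have := Finset.add_sum_erase D (fun δ ↦ f δ) hδ
    linarith
  refine ⟨D, fun δ hδ ↦ (hD.1 δ hδ).1, ?_, fun δ hδ ↦ (hD.1 δ hδ).2.2, hD.2⟩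
  refine linearIndependent_of_obtuse f (fun δ ↦ (hD.1 δ δ.2).2.1) fun δ γ hne ↦ ?_
  by_contra! hpos
  have hne' : (δ : V) ≠ γ := fun h ↦ hne (Subtype.ext h)
  obtain ⟨p, q, hp, hq, hpq0, hpq⟩ :=
    hΦ.exists_cartan_integers hc (hD.1 δ δ.2).1 (hD.1 γ γ.2).1
  have hδ0 := hΦ.inner_self_pos (hD.1 δ δ.2).1
  have hγ0 := hΦ.inner_self_pos (hD.1 γ γ.2).1
  have hp0 : 0 < p := by
    have : (0 : ℝ) < p * ⟪(δ : V), δ⟫_ℝ := by linarith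
    exact_mod_cast (pos_iff_pos_of_mul_pos this).2 hδ0
  have hq0 : 0 < q := by
    have : (0 : ℝ) < q * ⟪(γ : V), γ⟫_ℝ := by linarith
    exact_mod_cast (pos_iff_pos_of_mul_pos this).2 hγ0
  have hlt := hpq hne'.symm fun h ↦ by
    rw [h, inner_neg_right] at hpos
    linarith
  have h1 := key δ δ.2 γ γ.2 hne' q (by rw [real_inner_comm]; exact hq) hq0
  have h2 := key γ γ.2 δ δ.2 hne'.symm p hp hp0
  have hfδ := (hD.1 δ δ.2).2.1
  have hfγ := (hD.1 γ γ.2).2.1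
  have h3 : (p * q : ℝ) < 4 := by exact_mod_cast hlt
  have h4 : (2 * f δ) * (2 * f γ) ≤ (q * f γ) * (p * f δ) :=
    mul_le_mul h1 h2 (by linarith) (by linarith)
  have h5 := mul_lt_mul_of_pos_right h3 (mul_pos hfδ hfγ)
  linarith

theorem generatedRoot_of_mem_latticeSpan (hΦ : IsRootSystem Φ) (hc : IsCrystallographic Φ)
    {R : Set V} (hR : R ⊆ Φ) {β : V} (hβ : β ∈ Φ) (h : β ∈ latticeSpan R)
    (h' : coroot β ∈ latticeSpan (coroots R)) : GeneratedRoot R β := by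
  obtain ⟨D, hDΦ, hli, hDR, hRD⟩ := hΦ.exists_base hc hR
  have h1 : latticeSpan R ≤ latticeSpan (Set.range fun δ : D ↦ (δ : V)) := by
    have : (Set.range fun δ : D ↦ (δ : V)) = D := Subtype.range_coe
    rw [this]
    exact Submodule.span_le.2 fun α hα ↦ (hRD α hα).mem_latticeSpan hΦ hc hDΦ
  have h2 : latticeSpan (coroots R) ≤ latticeSpan (Set.range fun δ : D ↦ coroot (δ : V)) := by
    have : (Set.range fun δ : D ↦ coroot (δ : V)) = coroots (D : Set V) := by
      ext
      simp [coroots]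
    rw [this]
    refine Submodule.span_le.2 ?_
    rintro _ ⟨α, hα, rfl⟩
    exact (hRD α hα).coroot_mem_latticeSpan hΦ hc hDΦ
  obtain ⟨n, hn⟩ := (Submodule.mem_span_range_iff_exists_fun ℤ).1 (h1 h)
  obtain ⟨m, hm⟩ := (Submodule.mem_span_range_iff_exists_fun ℤ).1 (h2 h')
  have hn' : β = ∑ δ : D, (n δ : ℝ) • (δ : V) := by
    rw [← hn]
    exact Finset.sum_congr rfl fun δ _ ↦ (Int.cast_smul_eq_zsmul ℝ _ _).symm
  have hβ0 := (hΦ.inner_self_pos hβ).ne'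
  -- Independence of D lets the two expansions of the coroot of β be compared coefficientwise.
  have hcoef : ∀ δ : D, 2 / ⟪β, β⟫_ℝ * n δ = m δ * (2 / ⟪(δ : V), δ⟫_ℝ) := by
    refine fun δ ↦ congrFun (linearIndependent_iff_injective_fintypeLinearCombination.1 hli
      (a₁ := fun δ : D ↦ 2 / ⟪β, β⟫_ℝ * n δ)
      (a₂ := fun δ : D ↦ m δ * (2 / ⟪(δ : V), δ⟫_ℝ)) ?_) δ
    rw [Fintype.linearCombination_apply, Fintype.linearCombination_apply]
    calc _ = coroot β := by
            rw [coroot]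
            conv_rhs => rw [hn', Finset.smul_sum]
            simp only [mul_smul, ← hn']
      _ = _ := by
            rw [← hm]
            refine Finset.sum_congr rfl fun δ _ ↦ ?_
            rw [← Int.cast_smul_eq_zsmul ℝ, coroot, smul_smul]
  refine (generatedRoot_of_integral hΦ hc (δ := fun δ : D ↦ (δ : V)) (fun δ ↦ hDΦ δ.2) hβ
    (n := n) (m := m) (S := D) hn' (fun δ ↦ ?_) fun δ _ ↦ δ.2).trans hDR
  · have hδ0 := (hΦ.inner_self_pos (hDΦ δ.2)).ne'
    have := hcoef δ
    field_simp at this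
    linarith

end Lattices

/-! ### Obtuse circuits and their affine-type lifts -/

section ObtuseCircuits

variable {V : Type*} [NormedAddCommGroup V] [InnerProductSpace ℝ V] {Φ : Set V}
  {ι : Type*} [Fintype ι] {β : ι → V}

theorem linearCombination_int_eq (β : ι → V) (n : ι → ℤ) :
    Fintype.linearCombination ℤ β n = ∑ i, (n i : ℝ) • β i := by
  rw [Fintype.linearCombination_apply]
  exact Finset.sum_congr rfl fun i _ ↦ (Int.cast_smul_eq_zsmul ℝ _ _).symm

/-- The integer vector `n` is the coordinate vector of a root with respect to the family `β`, and
the corresponding coroot has integral coordinates with respect to the coroots of `β`. -/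
def IsIntegralLift (Φ : Set V) (β : ι → V) (n : ι → ℤ) : Prop :=
  Fintype.linearCombination ℤ β n ∈ Φ ∧ ∀ i, ∃ m : ℤ, n i * ⟪β i, β i⟫_ℝ =
    m * ⟪Fintype.linearCombination ℤ β n, Fintype.linearCombination ℤ β n⟫_ℝ

-- Diagonal terms are n_i²(β_i|β_i) = n_i m_i N, and doubled cross terms 2n_i n_j(β_i|β_j) become
-- n_j p_ij m_i N. This integrality in units of N is what forces coordinates to have one sign.
omit [Fintype ι] in
theorem exists_int_inner_partialSum (hΦ : IsRootSystem Φ) (hc : IsCrystallographic Φ)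
    (hβ : ∀ i, β i ∈ Φ) {n m : ι → ℤ} {N : ℝ} (h : ∀ i, n i * ⟪β i, β i⟫_ℝ = m i * N)
    (s : Finset ι) :
    ∃ z : ℤ, ⟪∑ i ∈ s, (n i : ℝ) • β i, ∑ i ∈ s, (n i : ℝ) • β i⟫_ℝ = z * N := by
  classical
  choose p _ hp _ using fun i j ↦ hΦ.exists_cartan_integers hc (hβ i) (hβ j)
  induction s using Finset.induction_on with
  | empty => exact ⟨0, by simp⟩
  | insert a s ha ih =>
    obtain ⟨z, hz⟩ := ih
    refine ⟨n a * m a + ∑ j ∈ s, n j * p a j * m a + z, ?_⟩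
    have h2 : 2 * n a * ⟪β a, ∑ i ∈ s, (n i : ℝ) • β i⟫_ℝ = ∑ j ∈ s, n j * p a j * m a * N := by
      rw [inner_sum, Finset.mul_sum]
      refine Finset.sum_congr rfl fun j _ ↦ ?_
      rw [real_inner_smul_right]
      linear_combination (n a * n j : ℝ) * hp a j + (n j * p a j : ℝ) * h a
    rw [Finset.sum_insert ha, inner_add_left, inner_add_right, inner_add_right, hz,
      real_inner_comm ((n a : ℝ) • β a) (∑ i ∈ s, (n i : ℝ) • β i), real_inner_smul_left, real_inner_smul_left,
      real_inner_smul_right]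
    push_cast
    rw [add_mul, add_mul, Finset.sum_mul, ← h2]
    linear_combination (n a : ℝ) * h a

/-- Coordinate vectors of roots with respect to an obtuse circuit have coordinates of one sign. -/
theorem IsIntegralLift.nonneg_or_nonpos (hΦ : IsRootSystem Φ) (hc : IsCrystallographic Φ)
    (hβ : ∀ i, β i ∈ Φ) (hobt : ∀ i j, i ≠ j → ⟪β i, β j⟫_ℝ ≤ 0)
    (hmin : ∀ r : ι → ℤ, Fintype.linearCombination ℤ β r = 0 → ∀ k, r k = 0 → r = 0)
    {n : ι → ℤ} (hn : IsIntegralLift Φ β n) : 0 ≤ n ∨ n ≤ 0 := by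
  classical
  by_contra! hcon
  obtain ⟨h1, h2⟩ := hcon
  obtain ⟨i, hi⟩ : ∃ i, n i < 0 := by
    by_contra! h
    exact h1 h
  obtain ⟨j, hj⟩ : ∃ i, 0 < n i := by
    by_contra! h
    exact h2 h
  choose m hm using hn.2
  have hN := hΦ.inner_self_pos hn.1
  set N := ⟪Fintype.linearCombination ℤ β n, Fintype.linearCombination ℤ β n⟫_ℝ with hNdef
  obtain ⟨z₁, hz₁⟩ := exists_int_inner_partialSum hΦ hc hβ hm (Finset.univ.filter fun i ↦ 0 < n i)
  obtain ⟨z₂, hz₂⟩ :=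
    exists_int_inner_partialSum hΦ hc hβ hm (Finset.univ.filter fun i ↦ ¬ 0 < n i)
  have hsum := Finset.sum_filter_add_sum_filter_not Finset.univ (fun i ↦ 0 < n i)
    fun i ↦ (n i : ℝ) • β i
  have hPQ : 0 ≤ ⟪∑ i with 0 < n i, (n i : ℝ) • β i, ∑ i with ¬ 0 < n i, (n i : ℝ) • β i⟫_ℝ := by
    simp only [sum_inner, inner_sum, real_inner_smul_left, real_inner_smul_right]
    refine Finset.sum_nonneg fun k hk ↦ Finset.sum_nonneg fun l hl ↦ ?_
    simp only [Finset.mem_filter, Finset.mem_univ, true_and, not_lt] at hk hl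
    exact mul_nonneg_of_nonpos_of_nonpos (by exact_mod_cast hk)
      (mul_nonpos_of_nonneg_of_nonpos (by exact_mod_cast hl.le)
        (hobt _ _ (by rintro rfl; omega)))
  -- A vanishing partial sum is a relation with a zero coefficient, hence trivial by `hmin`.
  have hzero : ∀ (P : ι → Prop) [DecidablePred P],
      ⟪∑ i with P i, (n i : ℝ) • β i, ∑ i with P i, (n i : ℝ) • β i⟫_ℝ = 0 →
      ∀ k l, ¬ P k → P l → n l = 0 := by
    intro P _ h k l hk hl
    have := hmin (fun i ↦ if P i then n i else 0) ?_ k (if_neg hk)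
    · simpa [hl] using congrFun this l
    · rw [linearCombination_int_eq, ← inner_self_eq_zero.1 h, Finset.sum_filter]
      exact Finset.sum_congr rfl fun i _ ↦ by split_ifs <;> simp
  have h3 : N = z₁ * N + z₂ * N +
      2 * ⟪∑ i with 0 < n i, (n i : ℝ) • β i, ∑ i with ¬ 0 < n i, (n i : ℝ) • β i⟫_ℝ := by
    rw [← hz₁, ← hz₂]
    nth_rewrite 1 [hNdef]
    rw [linearCombination_int_eq, ← hsum, inner_add_left, inner_add_right, inner_add_right,
      real_inner_comm (∑ i with 0 < n i, (n i : ℝ) • β i)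
        (∑ i with ¬ 0 < n i, (n i : ℝ) • β i)]
    ring
  have hnn : ∀ z : ℤ, ∀ x : V, ⟪x, x⟫_ℝ = z * N → 0 ≤ z := by
    intro z x h
    have : (0 : ℝ) ≤ z * N := h ▸ real_inner_self_nonneg
    exact_mod_cast nonneg_of_mul_nonneg_left this hN
  have hz₁0 := hnn _ _ hz₁
  have hz₂0 := hnn _ _ hz₂
  have h4 : z₁ + z₂ ≤ 1 := by
    have : ((z₁ + z₂ : ℤ) : ℝ) ≤ 1 := by
      refine le_of_mul_le_mul_right ?_ hN
      push_cast
      linarith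
    exact_mod_cast this
  -- The two partial sums have norms z₁N and z₂N and nonnegative inner product, while their sum has
  -- norm N; so one of them vanishes.
  rcases (by omega : z₁ = 0 ∨ z₂ = 0) with h | h
  · have := hzero (fun i ↦ 0 < n i) (by rw [hz₁, h]; simp) i j hi.not_gt hj
    omega
  · have := hzero (fun i ↦ ¬ 0 < n i) (by rw [hz₂, h]; simp) j i (not_not.2 hj) hi.not_gt
    omega

theorem IsIntegralLift.single [DecidableEq ι] (hβ : ∀ i, β i ∈ Φ) (i : ι) :
    IsIntegralLift Φ β (Pi.single i 1) := by
  have h : Fintype.linearCombination ℤ β (Pi.single i 1) = β i := by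
    rw [Fintype.linearCombination_apply_single, one_smul]
  refine ⟨h ▸ hβ i, fun j ↦ ?_⟩
  rw [h]
  by_cases hj : j = i
  · exact ⟨1, by simp [hj]⟩
  · exact ⟨0, by simp [hj]⟩

theorem linearCombination_sub_zsmul (hΦ : IsRootSystem Φ) {d n : ι → ℤ}
    (hd : IsIntegralLift Φ β d) {p : ℤ}
    (hp : 2 * ⟪Fintype.linearCombination ℤ β d, Fintype.linearCombination ℤ β n⟫_ℝ =
      p * ⟪Fintype.linearCombination ℤ β d, Fintype.linearCombination ℤ β d⟫_ℝ) :
    Fintype.linearCombination ℤ β (n - p • d) =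
      rootReflection (Fintype.linearCombination ℤ β d) (Fintype.linearCombination ℤ β n) := by
  rw [rootReflection_eq_sub (hΦ.ne_zero hd.1) hp, map_sub, map_zsmul, Int.cast_smul_eq_zsmul]

theorem IsIntegralLift.reflect (hΦ : IsRootSystem Φ) (hc : IsCrystallographic Φ) {d n : ι → ℤ}
    (hd : IsIntegralLift Φ β d) (hn : IsIntegralLift Φ β n) {p : ℤ}
    (hp : 2 * ⟪Fintype.linearCombination ℤ β d, Fintype.linearCombination ℤ β n⟫_ℝ =
      p * ⟪Fintype.linearCombination ℤ β d, Fintype.linearCombination ℤ β d⟫_ℝ) :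
    IsIntegralLift Φ β (n - p • d) := by
  have h := linearCombination_sub_zsmul hΦ hd hp
  refine ⟨h ▸ hΦ.reflection_mem hd.1 hn.1, fun i ↦ ?_⟩
  obtain ⟨-, q, -, hq, -⟩ := hΦ.exists_cartan_integers hc hd.1 hn.1
  obtain ⟨m, hm⟩ := hn.2 i
  obtain ⟨l, hl⟩ := hd.2 i
  refine ⟨m - l * q, ?_⟩
  rw [h, inner_rootReflection_self, Pi.sub_apply, Pi.smul_apply, smul_eq_mul]
  push_cast
  linear_combination hm - (p : ℝ) * hl + (l : ℝ) * (hp - hq)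

/-- Reflections lift to n ↦ n - p d on coordinate vectors. The set A leaves room for a constraint
stable under this operation, such as lying in the kernel of a functional. -/
theorem GeneratedRoot.exists_integralLift (hΦ : IsRootSystem Φ) (hc : IsCrystallographic Φ)
    {D : Set V} {A : Set (ι → ℤ)}
    (hA : ∀ d ∈ A, ∀ n ∈ A, ∀ p : ℤ, n - p • d ∈ A)
    (hD : ∀ δ ∈ D, ∃ n ∈ A, IsIntegralLift Φ β n ∧ Fintype.linearCombination ℤ β n = δ)
    {γ : V} (h : GeneratedRoot D γ) :
    ∃ n ∈ A, IsIntegralLift Φ β n ∧ Fintype.linearCombination ℤ β n = γ := by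
  induction h with
  | of_mem hδ => exact hD _ hδ
  | reflection hδ _ ih =>
    obtain ⟨d, hdA, hd, rfl⟩ := hD _ hδ
    obtain ⟨n, hnA, hn, rfl⟩ := ih
    obtain ⟨p, -, hp, -⟩ := hΦ.exists_cartan_integers hc hd.1 hn.1
    exact ⟨n - p • d, hA d hdA n hnA p, hd.reflect hΦ hc hn hp,
      linearCombination_sub_zsmul hΦ hd hp⟩

theorem GeneratedRoot.exists_integralLift_range (hΦ : IsRootSystem Φ)
    (hc : IsCrystallographic Φ) (hβ : ∀ i, β i ∈ Φ) {γ : V}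
    (h : GeneratedRoot (Set.range β) γ) :
    ∃ n, IsIntegralLift Φ β n ∧ Fintype.linearCombination ℤ β n = γ := by
  classical
  obtain ⟨n, -, hn⟩ := h.exists_integralLift hΦ hc (A := Set.univ) (β := β) (by simp) (by
    rintro _ ⟨i, rfl⟩
    exact ⟨Pi.single i 1, trivial, .single hβ i, by
      rw [Fintype.linearCombination_apply_single, one_smul]⟩)
  exact ⟨n, hn⟩

/-- The functional `a` is positive on the relation `c`, and every root generated by `β` has a
coordinate vector in its kernel. -/
def IsSpecialFunctional (Φ : Set V) (β : ι → V) (c : ι → ℤ) (a : ι → ℝ) : Prop :=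
  0 < Fintype.linearCombination ℤ a c ∧ ∀ γ, GeneratedRoot (Set.range β) γ →
    ∃ n, Fintype.linearCombination ℤ a n = 0 ∧ IsIntegralLift Φ β n ∧
      Fintype.linearCombination ℤ β n = γ

theorem exists_isSpecialFunctional (hΦ : IsRootSystem Φ) (hc : IsCrystallographic Φ)
    (hβ : ∀ i, β i ∈ Φ) {c : ι → ℤ} (hc0 : c ≠ 0) (hrel : Fintype.linearCombination ℤ β c = 0) :
    ∃ a : ι → ℝ, IsSpecialFunctional Φ β c a := by
  classical
  obtain ⟨D, hDΦ, hli, hDR, hRD⟩ := hΦ.exists_base hc (R := Set.range β) (by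
    rintro _ ⟨i, rfl⟩
    exact hβ i)
  choose d hd hdδ using fun δ : D ↦ (hDR δ δ.2).exists_integralLift_range hΦ hc hβ
  have hcast : ∀ n : ι → ℤ, Fintype.linearCombination ℤ β n =
      Fintype.linearCombination ℝ β (fun i ↦ (n i : ℝ)) := fun n ↦ by
    rw [linearCombination_int_eq, Fintype.linearCombination_apply]
  -- The family β sends c to 0 but the lifts d to independent vectors, so a functional can kill the
  -- lifts without killing c.
  have hnot : (fun i ↦ (c i : ℝ)) ∉
      Submodule.span ℝ (Set.range fun δ : D ↦ fun i ↦ (d δ i : ℝ)) := by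
    intro hmem
    obtain ⟨x, hx⟩ := (Submodule.mem_span_range_iff_exists_fun ℝ).1 hmem
    have h1 : ∑ δ, x δ • (δ : V) = 0 := by
      rw [← hrel, hcast, ← hx, map_sum]
      refine Finset.sum_congr rfl fun δ _ ↦ ?_
      rw [map_smul, ← hcast, hdδ]
    have h2 := Fintype.linearIndependent_iff.1 hli x h1
    refine hc0 (funext fun i ↦ ?_)
    have := congrFun hx i
    simp only [h2, zero_smul, Finset.sum_const_zero, Pi.zero_apply] at this
    exact_mod_cast this.symm
  obtain ⟨f, hfc, hf⟩ := Submodule.exists_le_ker_of_notMem hnot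
  -- The scaling by f(c) makes the value at c the square f(c)², hence positive.
  have ha : ∀ n : ι → ℤ, Fintype.linearCombination ℤ
      (fun i ↦ f (fun i ↦ (c i : ℝ)) * f (Pi.single i 1)) n =
      f (fun i ↦ (c i : ℝ)) * f (fun i ↦ (n i : ℝ)) := by
    intro n
    rw [LinearMap.pi_apply_eq_sum_univ f (fun i ↦ (n i : ℝ)), linearCombination_int_eq,
      Finset.mul_sum]
    refine Finset.sum_congr rfl fun i _ ↦ ?_
    rw [smul_eq_mul, smul_eq_mul]
    have : (Pi.single i 1 : ι → ℝ) = fun j ↦ if i = j then 1 else 0 := by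
      ext j
      simp [Pi.single_apply, eq_comm]
    rw [this]
    ring
  refine ⟨fun i ↦ f (fun i ↦ (c i : ℝ)) * f (Pi.single i 1), ?_, fun γ hγ ↦ ?_⟩
  · rw [ha]
    exact mul_self_pos.2 hfc
  · obtain ⟨n, hn⟩ := (hγ.trans (E := D) (by
      rintro _ ⟨i, rfl⟩
      exact hRD _ ⟨i, rfl⟩)).exists_integralLift hΦ hc (β := β)
        (A := {n | Fintype.linearCombination ℤ
          (fun i ↦ f (fun i ↦ (c i : ℝ)) * f (Pi.single i 1)) n = 0}) (by
        intro d hd n hn p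
        rw [Set.mem_ofPred_eq] at hd hn ⊢
        rw [map_sub, map_zsmul, hd, hn, smul_zero, sub_zero]) (by
        intro δ hδ
        refine ⟨d ⟨δ, hδ⟩, ?_, hd _, hdδ _⟩
        have := hf (Submodule.subset_span ⟨⟨δ, hδ⟩, rfl⟩)
        rw [Set.mem_ofPred_eq, ha, LinearMap.mem_ker.1 this, mul_zero])
    exact ⟨n, hn⟩

/-- The nonnegative coordinate vectors of roots on which the functional `a` is negative. -/
def negativeLifts (Φ : Set V) (β : ι → V) (a : ι → ℝ) : Set (ι → ℤ) :=
  {n | IsIntegralLift Φ β n ∧ 0 ≤ n ∧ Fintype.linearCombination ℤ a n < 0}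

/-- Lifts of one root differ by multiples of c. As the functional is positive on c, negativity
bounds that multiple above, and nonnegativity of n bounds the coordinates below. -/
theorem finite_negativeLifts (hΦ : IsRootSystem Φ)
    (hmin : ∀ r : ι → ℤ, Fintype.linearCombination ℤ β r = 0 → ∀ k, r k = 0 → r = 0)
    {c : ι → ℤ} (hc0 : ∀ i, 0 < c i) (hrel : Fintype.linearCombination ℤ β c = 0) {a : ι → ℝ}
    (ha : 0 < Fintype.linearCombination ℤ a c) : (negativeLifts Φ β a).Finite := by
  classical
  refine (hΦ.finite.biUnion (t := fun γ ↦ {n | n ∈ negativeLifts Φ β a ∧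
    Fintype.linearCombination ℤ β n = γ}) fun γ _ ↦ ?_).subset fun n hn ↦
      Set.mem_biUnion hn.1.1 ⟨hn, rfl⟩
  rcases Set.eq_empty_or_nonempty {n | n ∈ negativeLifts Φ β a ∧
    Fintype.linearCombination ℤ β n = γ} with h | ⟨n', hn', hγ'⟩
  · rw [h]
    exact Set.finite_empty
  refine (Set.finite_Icc (0 : ι → ℤ) fun i ↦ n' i + ⌈-(c i * Fintype.linearCombination ℤ a n') /
    Fintype.linearCombination ℤ a c⌉).subset ?_
  rintro n ⟨hn, hγ⟩
  refine ⟨hn.2.1, fun i ↦ ?_⟩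
  have h1 : c i • (n - n') - (n - n') i • c = 0 := by
    refine hmin _ ?_ i ?_
    · rw [map_sub, map_zsmul, map_zsmul, hrel, map_sub, hγ, hγ']
      simp
    · simp [mul_comm]
  have h2 := congrArg (Fintype.linearCombination ℤ a) h1
  rw [map_sub, map_zsmul, map_zsmul, map_sub, map_zero, zsmul_eq_mul, zsmul_eq_mul,
    Pi.sub_apply] at h2
  have h3 : (c i : ℝ) * Fintype.linearCombination ℤ a n < 0 :=
    mul_neg_of_pos_of_neg (by exact_mod_cast hc0 i) hn.2.2
  have h4 : ((n i - n' i : ℤ) : ℝ) ≤ -(c i * Fintype.linearCombination ℤ a n') /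
      Fintype.linearCombination ℤ a c := by
    rw [le_div_iff₀ ha]
    linarith
  have h5 : n i - n' i ≤ ⌈-(c i * Fintype.linearCombination ℤ a n') /
      Fintype.linearCombination ℤ a c⌉ := by
    exact_mod_cast h4.trans (Int.le_ceil _)
  linarith

/-- Take a' = a ∘ s_i. As for lengths in a Weyl group, s_i embeds the negative lifts for a' into
those for a, and misses the unit vector e_i. -/
theorem IsSpecialFunctional.exists_ncard_lt (hΦ : IsRootSystem Φ) (hc : IsCrystallographic Φ)
    (hβ : ∀ i, β i ∈ Φ) (hobt : ∀ i j, i ≠ j → ⟪β i, β j⟫_ℝ ≤ 0)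
    (hmin : ∀ r : ι → ℤ, Fintype.linearCombination ℤ β r = 0 → ∀ k, r k = 0 → r = 0)
    {c : ι → ℤ} (hc0 : ∀ i, 0 < c i) (hrel : Fintype.linearCombination ℤ β c = 0) {a : ι → ℝ}
    (ha : IsSpecialFunctional Φ β c a) {i : ι} (hai : a i < 0) :
    ∃ a', IsSpecialFunctional Φ β c a' ∧
      (negativeLifts Φ β a').ncard < (negativeLifts Φ β a).ncard := by
  classical
  choose A _ hA _ using fun j ↦ hΦ.exists_cartan_integers hc (hβ i) (hβ j)
  have hi0 := (hΦ.inner_self_pos (hβ i)).ne'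
  have hAi : A i = 2 := by
    have := mul_right_cancel₀ hi0 (hA i)
    exact_mod_cast this.symm
  let P := Fintype.linearCombination ℤ A
  let e : ι → ℤ := Pi.single i 1
  have hπe : Fintype.linearCombination ℤ β e = β i := by
    rw [Fintype.linearCombination_apply_single, one_smul]
  have hae : Fintype.linearCombination ℤ a e = a i := by
    rw [Fintype.linearCombination_apply_single, one_smul]
  have hPe : P e = 2 := by
    rw [Fintype.linearCombination_apply_single, one_smul, hAi]
  have he : IsIntegralLift Φ β e := .single hβ i
  have hP : ∀ n, 2 * ⟪β i, Fintype.linearCombination ℤ β n⟫_ℝ = P n * ⟪β i, β i⟫_ℝ := by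
    intro n
    rw [linearCombination_int_eq, inner_sum, Finset.mul_sum, Fintype.linearCombination_apply,
      Int.cast_sum, Finset.sum_mul]
    refine Finset.sum_congr rfl fun j _ ↦ ?_
    rw [real_inner_smul_right, smul_eq_mul]
    push_cast
    linear_combination (n j : ℝ) * hA j
  let a' : ι → ℝ := fun j ↦ a j - A j * a i
  have ha'L : ∀ n, Fintype.linearCombination ℤ a' n =
      Fintype.linearCombination ℤ a n - P n * a i := by
    intro n
    rw [linearCombination_int_eq, linearCombination_int_eq, Fintype.linearCombination_apply,
      Int.cast_sum, Finset.sum_mul, ← Finset.sum_sub_distrib]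
    refine Finset.sum_congr rfl fun j _ ↦ ?_
    simp only [smul_eq_mul, a']
    push_cast
    ring
  have hσa : ∀ n, Fintype.linearCombination ℤ a (n - P n • e) =
      Fintype.linearCombination ℤ a' n := by
    intro n
    rw [map_sub, map_zsmul, hae, ha'L, zsmul_eq_mul]
  have hPσ : ∀ n, P (n - P n • e) = -P n := by
    intro n
    rw [map_sub, map_zsmul, hPe, smul_eq_mul]
    ring
  have hσσ : ∀ n, n - P n • e - P (n - P n • e) • e = n := by
    intro n
    rw [hPσ, neg_smul]
    abel
  have hσ : ∀ n, IsIntegralLift Φ β n → IsIntegralLift Φ β (n - P n • e) := fun n hn ↦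
    he.reflect hΦ hc hn (by rw [hπe, hP])
  refine ⟨a', ⟨?_, fun γ hγ ↦ ?_⟩, ?_⟩
  · have : P c = 0 := by
      have := hP c
      rw [hrel, inner_zero_right, mul_zero] at this
      exact_mod_cast (mul_eq_zero.1 this.symm).resolve_right hi0
    rw [ha'L, this]
    simpa using ha.1
  · have hi : GeneratedRoot (Set.range β) (β i) := .of_mem ⟨i, rfl⟩
    obtain ⟨n, han, hn, hnγ⟩ := ha.2 _ (hi.reflection' hγ)
    refine ⟨n - P n • e, ?_, hσ n hn, ?_⟩
    · rw [← hσa, hσσ, han]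
    · rw [linearCombination_sub_zsmul hΦ he (by rw [hπe, hP]), hπe, hnγ,
        rootReflection_rootReflection_self]
  · have hfin := finite_negativeLifts hΦ hmin hc0 hrel ha.1
    have hemem : e ∈ negativeLifts Φ β a :=
      ⟨he, Pi.single_nonneg.2 zero_le_one, by rw [hae]; exact hai⟩
    refine lt_of_le_of_lt (Set.ncard_le_ncard_of_injOn (fun n ↦ n - P n • e)
      (t := negativeLifts Φ β a \ {e}) ?_ ?_ (hfin.subset Set.sdiff_subset))
      (Set.ncard_sdiff_singleton_lt_of_mem hemem hfin)
    · rintro n ⟨hn, hn0, hna⟩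
      have hne : n ≠ e := by
        rintro rfl
        rw [ha'L, hae, hPe] at hna
        push_cast at hna
        linarith
      -- A positive coordinate away from i is untouched by s_i, so sign coherence keeps the
      -- reflected vector nonnegative.
      obtain ⟨j, hji, hj⟩ : ∃ j, j ≠ i ∧ n j ≠ 0 := by
        by_contra! hcon
        have h1 : n = n i • e := by
          ext j
          by_cases h : j = i
          · simp [h, e]
          · simp [h, e, hcon j h]
        have h2 := hn.1
        have h3 : Fintype.linearCombination ℤ β n = (n i : ℝ) • β i := by
          conv_lhs => rw [h1]
          rw [map_zsmul, hπe, Int.cast_smul_eq_zsmul]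
        have h4 : (n i : ℝ) = 1 ∨ (n i : ℝ) = -1 := by
          have h0 := hΦ.ne_zero (hβ i)
          refine (hΦ.eq_or_eq_neg_of_smul (hβ i) h2 h3).imp (fun h ↦ ?_) fun h ↦ ?_
          · exact smul_left_injective ℝ h0 (by simp only [← h3, h, one_smul])
          · exact smul_left_injective ℝ h0 (by simp only [← h3, h, neg_smul, one_smul])
        have h5 : n i = 1 := by
          have := hn0 i
          rcases h4 with h | h
          · exact_mod_cast h
          · have : n i = -1 := by exact_mod_cast h
            simp only [Pi.zero_apply] at *
            omega
        exact hne (by rw [h1, h5, one_smul])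
      have hσj : (n - P n • e) j = n j := by simp [e, hji]
      have hnj : 0 < n j := lt_of_le_of_ne (hn0 j) hj.symm
      refine ⟨⟨hσ n hn, ?_, by rw [hσa]; exact hna⟩, fun h ↦ ?_⟩
      · refine ((hσ n hn).nonneg_or_nonpos hΦ hc hβ hobt hmin).resolve_right fun h ↦ ?_
        have := h j
        rw [hσj] at this
        exact hnj.not_ge this
      · have := congrFun h j
        rw [hσj] at this
        exact hj (by simp [this, e, hji])
    · intro n _ n' _ h
      simp only at h
      rw [← hσσ n, h, hσσ]

/-- In a minimal linear relation with positive coefficients between pairwise obtuse roots, some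
root is generated by the others. -/
theorem exists_generatedRoot_of_obtuse (hΦ : IsRootSystem Φ) (hc : IsCrystallographic Φ)
    [Nonempty ι] (hβ : ∀ i, β i ∈ Φ) (hobt : ∀ i j, i ≠ j → ⟪β i, β j⟫_ℝ ≤ 0)
    (hmin : ∀ r : ι → ℤ, Fintype.linearCombination ℤ β r = 0 → ∀ k, r k = 0 → r = 0)
    {c : ι → ℤ} (hc0 : ∀ i, 0 < c i) (hrel : Fintype.linearCombination ℤ β c = 0) :
    ∃ k, GeneratedRoot (β '' {k}ᶜ) (β k) := by
  classical
  have hS : {a | IsSpecialFunctional Φ β c a}.Nonempty := exists_isSpecialFunctional hΦ hc hβ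
    (fun h ↦ (hc0 (Classical.arbitrary ι)).ne' (congrFun h _)) hrel
  obtain ⟨a, ha, hamin⟩ := (measure fun a ↦ (negativeLifts Φ β a).ncard).wf.has_min _ hS
  have ha0 : ∀ i, 0 ≤ a i := by
    intro i
    by_contra! hai
    obtain ⟨a', ha', hlt⟩ := ha.exists_ncard_lt hΦ hc hβ hobt hmin hc0 hrel hai
    exact hamin a' ha' hlt
  obtain ⟨hac, haγ⟩ := ha
  obtain ⟨k, hk⟩ : ∃ k, 0 < a k := by
    by_contra! h
    have h0 : a = 0 := funext fun i ↦ le_antisymm (h i) (ha0 i)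
    simp [h0, Fintype.linearCombination_apply] at hac
  obtain ⟨n, han, hn, hnk⟩ := haγ (β k) (.of_mem ⟨k, rfl⟩)
  -- All terms n_i a_i have the same sign and sum to zero, while a_k > 0; so β_k is integrally
  -- expressed by the other members.
  have hnk0 : n k = 0 := by
    rw [linearCombination_int_eq] at han
    have : (n k : ℝ) * a k = 0 := by
      rcases hn.nonneg_or_nonpos hΦ hc hβ hobt hmin with h | h
      · exact (Finset.sum_eq_zero_iff_of_nonneg fun i _ ↦
          mul_nonneg (by exact_mod_cast h i) (ha0 i)).1 han k (Finset.mem_univ k)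
      · exact (Finset.sum_eq_zero_iff_of_nonpos fun i _ ↦
          mul_nonpos_of_nonpos_of_nonneg (by exact_mod_cast h i) (ha0 i)).1 han k
            (Finset.mem_univ k)
    exact_mod_cast (mul_eq_zero.1 this).resolve_right hk.ne'
  choose m hm using hn.2
  rw [hnk] at hm
  refine ⟨k, generatedRoot_of_integral hΦ hc hβ (hβ k) (n := n) (m := m) ?_ hm fun i hi ↦
    ⟨i, fun h ↦ hi (by rw [Set.mem_singleton_iff.1 h, hnk0]), rfl⟩⟩
  rw [← linearCombination_int_eq, hnk]

end ObtuseCircuits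

/-! ### Irredundant families of roots are linearly independent -/

section IrredundantFamilies

variable {V : Type*} [NormedAddCommGroup V] [InnerProductSpace ℝ V] {Φ : Set V}

/-- No member of the family `β` is generated by the other ones. -/
def IsIrredundant {ι : Type*} (β : ι → V) : Prop :=
  ∀ k, ¬ GeneratedRoot (β '' {k}ᶜ) (β k)

/-- A real relation lies in the kernel of the integral Cartan matrix, which therefore has a nonzero
integral kernel vector. The resulting combination is orthogonal to every β_i, hence to itself. -/
theorem exists_int_relation {ι : Type*} [Fintype ι] (hΦ : IsRootSystem Φ)
    (hc : IsCrystallographic Φ) {β : ι → V} (hβ : ∀ i, β i ∈ Φ)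
    (hdep : ¬ LinearIndependent ℝ β) :
    ∃ r : ι → ℤ, r ≠ 0 ∧ Fintype.linearCombination ℤ β r = 0 := by
  classical
  choose A _ hA _ using fun i j ↦ hΦ.exists_cartan_integers hc (hβ i) (hβ j)
  obtain ⟨g, hg, i, hgi⟩ := Fintype.not_linearIndependent_iff.1 hdep
  have hrow : ∀ (x : ι → ℝ) (i : ι),
      2 * ⟪β i, ∑ j, x j • β j⟫_ℝ = (∑ j, (A i j : ℝ) * x j) * ⟪β i, β i⟫_ℝ := by
    intro x i
    rw [inner_sum, Finset.mul_sum, Finset.sum_mul]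
    refine Finset.sum_congr rfl fun j _ ↦ ?_
    rw [real_inner_smul_right]
    linear_combination x j * hA i j
  have hdet : (Matrix.of A).det = 0 := by
    have h1 : ((Matrix.of A).map (Int.castRingHom ℝ)).det = 0 := by
      refine Matrix.exists_mulVec_eq_zero_iff.1 ⟨g, fun h ↦ hgi (congrFun h i), funext fun i ↦ ?_⟩
      have := hrow g i
      rw [hg, inner_zero_right, mul_zero] at this
      exact (mul_eq_zero.1 this.symm).resolve_right (hΦ.inner_self_pos (hβ i)).ne'
    have h2 := (Int.castRingHom ℝ).map_det (Matrix.of A)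
    rw [RingHom.mapMatrix_apply, h1] at h2
    exact Int.cast_eq_zero.1 h2
  obtain ⟨r, hr0, hr⟩ := Matrix.exists_mulVec_eq_zero_iff.2 hdet
  refine ⟨r, hr0, ?_⟩
  rw [linearCombination_int_eq, ← inner_self_eq_zero (𝕜 := ℝ), sum_inner]
  refine Finset.sum_eq_zero fun i _ ↦ ?_
  have h3 : ∑ j, (A i j : ℝ) * r j = 0 := by exact_mod_cast congrFun hr i
  have h4 := hrow (fun j ↦ r j) i
  rw [h3, zero_mul] at h4
  rw [real_inner_smul_left, (mul_eq_zero.1 h4).resolve_left two_ne_zero, mul_zero]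

omit [InnerProductSpace ℝ V] in
theorem exists_coeff_of_mem_latticeSpan {ι : Type*} [Fintype ι] {β : ι → V} {k : ι} {x : V}
    (hx : x ∈ latticeSpan (β '' {k}ᶜ)) :
    ∃ n : ι → ℤ, n k = 0 ∧ Fintype.linearCombination ℤ β n = x := by
  classical
  induction hx using Submodule.span_induction with
  | mem x hx =>
    obtain ⟨i, hi, rfl⟩ := hx
    refine ⟨Pi.single i 1, Pi.single_eq_of_ne (Ne.symm hi) _, ?_⟩
    rw [Fintype.linearCombination_apply_single, one_smul]
  | zero => exact ⟨0, rfl, map_zero _⟩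
  | add x y _ _ hx hy =>
    obtain ⟨n, hn, rfl⟩ := hx
    obtain ⟨m, hm, rfl⟩ := hy
    exact ⟨n + m, by simp [hn, hm], map_add _ _ _⟩
  | smul a x _ hx =>
    obtain ⟨n, hn, rfl⟩ := hx
    exact ⟨a • n, by simp [hn], map_smul _ _ _⟩

omit [InnerProductSpace ℝ V] in
theorem linearCombination_update {ι : Type*} [Fintype ι] [DecidableEq ι] (β : ι → V) (i j : ι)
    (p : ℤ) (r : ι → ℤ) :
    Fintype.linearCombination ℤ (Function.update β i (β i - p • β j)) r =
      Fintype.linearCombination ℤ β (r - (p * r i) • Pi.single j 1) := by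
  have h : Function.update β i (β i - p • β j) = β - Pi.single i (p • β j) := by
    ext k
    by_cases hk : k = i
    · subst hk
      simp
    · simp [hk]
  rw [h, map_sub, map_zsmul, Fintype.linearCombination_apply_single, one_smul,
    Fintype.linearCombination_apply, Fintype.linearCombination_apply]
  simp only [Pi.sub_apply, smul_sub, Finset.sum_sub_distrib]
  congr 1
  rw [Finset.sum_eq_single i (fun k _ hk ↦ by simp [hk]) (by simp), Pi.single_eq_same, smul_smul,
    mul_comm]

/-- The smallest sum of coefficients of a relation with positive integral coefficients. -/
noncomputable def minRelationSum {ι : Type*} [Fintype ι] (β : ι → V) : ℕ :=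
  sInf {N | ∃ c : ι → ℤ, (∀ i, 0 < c i) ∧ Fintype.linearCombination ℤ β c = 0 ∧ ∑ i, c i = N}

section Update

variable {ι : Type*} [Fintype ι] [DecidableEq ι] {β : ι → V} {c : ι → ℤ} {i j : ι} {p : ℤ}

omit [InnerProductSpace ℝ V] in
theorem minRelationSum_lt_update
    (hmin : ∀ r : ι → ℤ, Fintype.linearCombination ℤ β r = 0 → ∀ k, r k = 0 → r = 0)
    (hc0 : ∀ i, 0 < c i) (hrel : Fintype.linearCombination ℤ β c = 0) (hij : i ≠ j)
    (hp : 0 < p) :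
    (∃ c' : ι → ℤ, (∀ i, 0 < c' i) ∧
      Fintype.linearCombination ℤ (Function.update β i (β i - p • β j)) c' = 0) ∧
    minRelationSum β < minRelationSum (Function.update β i (β i - p • β j)) := by
  have hex : ∃ c' : ι → ℤ, (∀ i, 0 < c' i) ∧
      Fintype.linearCombination ℤ (Function.update β i (β i - p • β j)) c' = 0 := by
    refine ⟨c + (p * c i) • Pi.single j 1, fun k ↦ ?_, ?_⟩
    · have h1 : (0 : ℤ) ≤ (Pi.single j 1 : ι → ℤ) k :=
        (Pi.single_nonneg.2 zero_le_one : (0 : ι → ℤ) ≤ Pi.single j 1) k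
      have h2 := mul_nonneg (mul_pos hp (hc0 i)).le h1
      have := hc0 k
      rw [Pi.add_apply, Pi.smul_apply, smul_eq_mul]
      omega
    · rw [linearCombination_update, ← hrel]
      congr 1
      simp [hij]
  refine ⟨hex, ?_⟩
  have hne : {N : ℕ | ∃ c : ι → ℤ, (∀ i, 0 < c i) ∧ Fintype.linearCombination ℤ
      (Function.update β i (β i - p • β j)) c = 0 ∧ ∑ i, c i = N}.Nonempty := by
    obtain ⟨c', h1, h2⟩ := hex
    exact ⟨(∑ i, c' i).toNat, c', h1, h2,
      (Int.toNat_of_nonneg (Finset.sum_nonneg fun i _ ↦ (h1 i).le)).symm⟩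
  obtain ⟨c', h1, h2, h3⟩ := Nat.sInf_mem hne
  rw [linearCombination_update] at h2
  set d := c' - (p * c' i) • (Pi.single j 1 : ι → ℤ) with hd
  have hdk : ∀ k, k ≠ j → d k = c' k := fun k hk ↦ by simp [hd, hk]
  have hdj : 0 < d j := by
    -- Pulled back to β, the relation d is proportional to c, and d_i = c'_i > 0 makes it positive;
    -- its sum is smaller than that of c' by p c'_i.
    have h4 : c i • d - d i • c = 0 := by
      refine hmin _ ?_ i ?_
      · rw [map_sub, map_zsmul, map_zsmul, hrel, h2, smul_zero, smul_zero, sub_zero]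
      · simp [mul_comm]
    have h5 := congrFun h4 j
    simp only [Pi.sub_apply, Pi.smul_apply, smul_eq_mul, Pi.zero_apply, hdk i hij] at h5
    have h6 : 0 < c i * d j := by
      have := mul_pos (h1 i) (hc0 j)
      linarith
    exact (pos_iff_pos_of_mul_pos h6).1 (hc0 i)
  have hd0 : ∀ k, 0 < d k := fun k ↦ by
    by_cases hk : k = j
    · exact hk ▸ hdj
    · exact hdk k hk ▸ h1 k
  have hsum : ∑ k, d k = ∑ k, c' k - p * c' i := by
    simp [hd, Finset.sum_sub_distrib, ← Finset.mul_sum]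
  have hle : minRelationSum β ≤ (∑ k, d k).toNat :=
    Nat.sInf_le ⟨d, hd0, h2, (Int.toNat_of_nonneg (Finset.sum_nonneg fun i _ ↦ (hd0 i).le)).symm⟩
  have hpos := mul_pos hp (h1 i)
  have h3' : ∑ k, c' k = (minRelationSum (Function.update β i (β i - p • β j)) : ℕ) := h3
  have := Finset.sum_nonneg fun k (_ : k ∈ Finset.univ) ↦ (hd0 k).le
  omega

theorem IsIrredundant.update (hΦ : IsRootSystem Φ) (hc : IsCrystallographic Φ)
    (hβ : ∀ i, β i ∈ Φ) (hirr : IsIrredundant β)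
    (hmin : ∀ r : ι → ℤ, Fintype.linearCombination ℤ β r = 0 → ∀ k, r k = 0 → r = 0)
    (hc0 : ∀ i, 0 < c i) (hrel : Fintype.linearCombination ℤ β c = 0) (hij : i ≠ j)
    (hp : 0 < p) (hrefl : rootReflection (β j) (β i) = β i - p • β j) :
    IsIrredundant (Function.update β i (β i - p • β j)) := by
  have hji := hij.symm
  have hmem : ∀ k, Function.update β i (β i - p • β j) k ∈ Φ := fun k ↦ by
    by_cases hk : k = i
    · subst hk
      rw [Function.update_self, ← hrefl]
      exact hΦ.reflection_mem (hβ j) (hβ k)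
    · rw [Function.update_of_ne hk]
      exact hβ k
  intro k hk
  -- Only k = j needs the circuit: an expression of β_j by the new others gives -n_i(c_j + p c_i) =
  -- c_i, impossible for integers since c_j > 0. Otherwise reflecting in β_j undoes the change.
  by_cases hkj : k = j
  · subst hkj
    obtain ⟨n, hnk, hn⟩ := exists_coeff_of_mem_latticeSpan (hk.mem_latticeSpan hΦ hc (by
      rintro _ ⟨l, -, rfl⟩
      exact hmem l))
    have h1 : Fintype.linearCombination ℤ (Function.update β i (β i - p • β k))
        (n - Pi.single k 1) = 0 := by
      rw [map_sub, hn, Fintype.linearCombination_apply_single, one_smul, sub_self]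
    rw [linearCombination_update] at h1
    set d := n - Pi.single k 1 - (p * (n - Pi.single k 1 : ι → ℤ) i) •
      (Pi.single k 1 : ι → ℤ) with hd
    have h4 : c i • d - d i • c = 0 := by
      refine hmin _ ?_ i ?_
      · rw [map_sub, map_zsmul, map_zsmul, hrel, h1, smul_zero, smul_zero, sub_zero]
      · simp [mul_comm]
    have h5 := congrFun h4 k
    have hdi : d i = n i := by simp [hd, hij]
    have hdk : d k = -1 - p * n i := by simp [hd, hij, hnk]
    simp only [Pi.sub_apply, Pi.smul_apply, smul_eq_mul, Pi.zero_apply, hdi, hdk] at h5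
    have hci := hc0 i
    have hck := hc0 k
    have h6 : -n i * (c k + p * c i) = c i := by linarith
    have h7 : 0 < c k + p * c i := by positivity
    have h8 : 0 < -n i := by
      rw [← h6] at hci
      exact (pos_iff_pos_of_mul_pos hci).2 h7
    nlinarith
  · by_cases hki : k = i
    · subst hki
      have h1 : Function.update β k (β k - p • β j) '' {k}ᶜ = β '' {k}ᶜ :=
        Set.image_congr fun l hl ↦ Function.update_of_ne hl _ _
      rw [h1, Function.update_self, ← hrefl] at hk
      exact hirr k (GeneratedRoot.of_reflection (.of_mem ⟨j, hji, rfl⟩) hk)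
    · rw [Function.update_of_ne hki] at hk
      refine hirr k (hk.trans ?_)
      rintro _ ⟨l, hl, rfl⟩
      by_cases hli : l = i
      · subst hli
        rw [Function.update_self, ← hrefl]
        exact GeneratedRoot.reflection ⟨j, Ne.symm hkj, rfl⟩ (.of_mem ⟨l, hl, rfl⟩)
      · rw [Function.update_of_ne hli]
        exact .of_mem ⟨l, hl, rfl⟩

end Update

theorem IsIrredundant.eq_zero_of_relation (hΦ : IsRootSystem Φ) (hc : IsCrystallographic Φ) :
    ∀ (n : ℕ) (α : Fin n → V), (∀ i, α i ∈ Φ) → IsIrredundant α →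
      ∀ r : Fin n → ℤ, Fintype.linearCombination ℤ α r = 0 → r = 0 := by
  classical
  intro n
  induction n with
  | zero => exact fun α _ _ r _ ↦ Subsingleton.elim _ _
  | succ n ih =>
  have hmin : ∀ β : Fin (n + 1) → V, (∀ i, β i ∈ Φ) → IsIrredundant β →
      ∀ r : Fin (n + 1) → ℤ, Fintype.linearCombination ℤ β r = 0 → ∀ k, r k = 0 → r = 0 := by
    intro β hβ hirr r hr k hk
    have h1 := ih (β ∘ k.succAbove) (fun i ↦ hβ _) (fun l hl ↦ hirr (k.succAbove l) (hl.mono ?_))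
      (r ∘ k.succAbove) ?_
    · ext l
      rcases Fin.eq_self_or_eq_succAbove k l with rfl | ⟨m, rfl⟩
      · exact hk
      · exact congrFun h1 m
    · rintro _ ⟨m, hm, rfl⟩
      exact ⟨k.succAbove m, fun h ↦ hm (Fin.succAbove_right_injective h), rfl⟩
    · rw [Fintype.linearCombination_apply, Fin.sum_univ_succAbove _ k, hk, zero_smul,
        zero_add] at hr
      rw [Fintype.linearCombination_apply]
      exact hr
  intro α hα hirr r hr
  by_contra hr0
  have hri : ∀ i, r i ≠ 0 := fun i hi ↦ hr0 (hmin α hα hirr r hr i hi)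
  let F : Set (Fin (n + 1) → V) := {β | (∀ i, β i ∈ Φ) ∧ IsIrredundant β ∧
    ∃ c : Fin (n + 1) → ℤ, (∀ i, 0 < c i) ∧ Fintype.linearCombination ℤ β c = 0}
  have hF : F.Finite := (Set.Finite.pi' fun _ ↦ hΦ.finite).subset fun β hβ ↦ hβ.1
  have hF0 : F.Nonempty := by
    -- Flipping signs of roots makes the relation positive without affecting what is generated.
    let β : Fin (n + 1) → V := fun i ↦ if r i < 0 then -α i else α i
    have h1 : ∀ D : Set V, ∀ i, GeneratedRoot D (β i) ↔ GeneratedRoot D (α i) := by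
      intro D i
      simp only [β]
      split_ifs
      · exact ⟨fun h ↦ neg_neg (α i) ▸ h.neg, fun h ↦ h.neg⟩
      · rfl
    refine ⟨β, fun i ↦ ?_, fun k hk ↦ hirr k (((h1 _ k).1 hk).trans ?_), fun i ↦ |r i|,
      fun i ↦ abs_pos.2 (hri i), ?_⟩
    · simp only [β]
      split_ifs
      exacts [hΦ.neg_mem (hα i), hα i]
    · rintro _ ⟨l, hl, rfl⟩
      exact (h1 _ l).2 (.of_mem ⟨l, hl, rfl⟩)
    · rw [← hr, Fintype.linearCombination_apply, Fintype.linearCombination_apply]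
      refine Finset.sum_congr rfl fun i _ ↦ ?_
      simp only [β]
      split_ifs with h
      · rw [abs_of_neg h, neg_smul, smul_neg, neg_neg]
      · rw [abs_of_nonneg (not_lt.1 h)]
  obtain ⟨β, ⟨hβ, hβirr, c, hc0, hrel⟩, hmax⟩ := Set.exists_max_image F minRelationSum hF hF0
  have hβmin := hmin β hβ hβirr
  by_cases hobt : ∀ i j, i ≠ j → ⟪β i, β j⟫_ℝ ≤ 0
  · obtain ⟨k, hk⟩ := exists_generatedRoot_of_obtuse hΦ hc hβ hobt hβmin hc0 hrel
    exact hβirr k hk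
  · push Not at hobt
    obtain ⟨i, j, hij, hpos⟩ := hobt
    obtain ⟨p, -, hp, -⟩ := hΦ.exists_cartan_integers hc (hβ j) (hβ i)
    have hrefl := rootReflection_eq_sub (hΦ.ne_zero (hβ j)) hp
    rw [Int.cast_smul_eq_zsmul] at hrefl
    have hp0 : 0 < p := by
      rw [real_inner_comm] at hp
      have : (0 : ℝ) < p * ⟪β j, β j⟫_ℝ := by linarith
      exact_mod_cast (pos_iff_pos_of_mul_pos this).2 (hΦ.inner_self_pos (hβ j))
    obtain ⟨hex, hlt⟩ := minRelationSum_lt_update hβmin hc0 hrel hij hp0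
    refine (hmax _ ⟨fun k ↦ ?_,
      hβirr.update hΦ hc hβ hβmin hc0 hrel hij hp0 hrefl, hex⟩).not_gt hlt
    by_cases hk : k = i
    · subst hk
      rw [Function.update_self, ← hrefl]
      exact hΦ.reflection_mem (hβ j) (hβ k)
    · rw [Function.update_of_ne hk]
      exact hβ k

/-- A set of roots none of which is generated by the other ones is linearly independent. -/
theorem linearIndepOn_of_irredundant (hΦ : IsRootSystem Φ) (hc : IsCrystallographic Φ)
    {R : Set V} (hR : R ⊆ Φ) (hirr : ∀ α ∈ R, ¬ GeneratedRoot (R \ {α}) α) :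
    LinearIndepOn ℝ id R := by
  have : Finite R := hΦ.finite.subset hR
  let e := (Finite.equivFin R).symm
  refine (linearIndependent_equiv e).1 ?_
  by_contra hdep
  have hmem : ∀ i, ((fun x : R ↦ id (x : V)) ∘ e) i ∈ Φ := fun i ↦ hR (e i).2
  obtain ⟨r, hr0, hr⟩ := exists_int_relation hΦ hc hmem hdep
  refine hr0 (IsIrredundant.eq_zero_of_relation hΦ hc _ _ hmem (fun k hk ↦ ?_) r hr)
  refine hirr _ (e k).2 (hk.mono ?_)
  rintro _ ⟨l, hl, rfl⟩
  exact ⟨(e l).2, fun h ↦ hl (e.injective (Subtype.ext h))⟩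

theorem linearIndepOn_coroots (hΦ : IsRootSystem Φ) {R : Set V} (hR : R ⊆ Φ)
    (h : LinearIndepOn ℝ id R) : LinearIndepOn ℝ id (coroots R) := by
  refine LinearIndepOn.id_image ?_
  exact LinearIndependent.units_smul h fun α ↦
    Units.mk0 (2 / ⟪(α : V), α⟫_ℝ) (div_ne_zero two_ne_zero (hΦ.inner_self_pos (hR α.2)).ne')

theorem linearIndepOn_int {R : Set V} (h : LinearIndepOn ℝ id R) : LinearIndepOn ℤ id R :=
  LinearIndependent.restrict_scalars (fun a b hab ↦ by simpa using hab) h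

end IrredundantFamilies

/-! ### Sign characters and conjugacy classes of reflections -/

section SignCharacters

variable {B W : Type*} [Group W] {M : CoxeterMatrix B}

theorem isConj_of_odd_pow_eq_one {G : Type*} [Group G] {s t : G} (hs : s * s = 1) (ht : t * t = 1)
    {n : ℕ} (hn : Odd n) (h : (s * t) ^ n = 1) : IsConj s t := by
  obtain ⟨k, rfl⟩ := hn
  have hs' : s⁻¹ = s := inv_eq_of_mul_eq_one_left hs
  have ht' : t⁻¹ = t := inv_eq_of_mul_eq_one_left ht
  have h1 : SemiconjBy s (s * t)⁻¹ (s * t) := by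
    rw [SemiconjBy, mul_inv_rev, hs', ht', mul_assoc]
  have h2 : s * ((s * t) ^ k)⁻¹ = (s * t) ^ k * s := by
    rw [← inv_pow]
    exact h1.pow_right k
  refine isConj_iff.2 ⟨(s * t) ^ k, ?_⟩
  have h3 : (s * t) ^ k * (s * t) ^ k * s * t = 1 := by
    rw [← h, mul_assoc, pow_succ, two_mul, pow_add]
  calc (s * t) ^ k * s * ((s * t) ^ k)⁻¹ = (s * t) ^ k * (s * t) ^ k * s := by
        rw [mul_assoc, h2, mul_assoc]
    _ = t := (eq_inv_of_mul_eq_one_left h3).trans ht'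

open Classical in
/-- A set of reflections generating a Coxeter group meets every conjugacy class of reflections. -/
theorem exists_isConj_of_closure_eq_top (cs : CoxeterSystem M W) {X : Set W}
    (hX : X ⊆ reflections cs) (hgen : Subgroup.closure X = ⊤) {t : W} (ht : cs.IsReflection t) :
    ∃ x ∈ X, IsConj x t := by
  by_contra! hcon
  -- This sign respects the Coxeter relations because an odd M i j makes the two simple reflections
  -- conjugate. If X missed the class of t, the character would be trivial on X but not at t.
  let f : B → ℤˣ := fun i ↦ if IsConj (cs.simple i) t then -1 else 1
  have hf : CoxeterMatrix.IsLiftable M f := by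
    intro i j
    by_cases hij : IsConj (cs.simple i) t ↔ IsConj (cs.simple j) t
    · have : f i = f j := by simp only [f, hij]
      rw [this, ← sq, Int.units_sq, one_pow]
    · have heven : Even (M i j) := by
        by_contra hodd
        have := isConj_of_odd_pow_eq_one (cs.simple_mul_simple_self i)
          (cs.simple_mul_simple_self j) (Nat.not_even_iff_odd.1 hodd)
          (cs.simple_mul_simple_pow i j)
        exact hij ⟨this.symm.trans, this.trans⟩
      obtain ⟨k, hk⟩ := heven
      rw [hk, ← two_mul, pow_mul, Int.units_sq, one_pow]
  let ε : W →* ℤˣ := cs.lift ⟨f, hf⟩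
  have hε : ∀ w i, ε (w * cs.simple i * w⁻¹) = f i := by
    intro w i
    rw [map_mul, map_mul, map_inv, mul_comm, inv_mul_cancel_left]
    exact cs.lift_apply_simple hf i
  have hker : Subgroup.closure X ≤ ε.ker := by
    rw [Subgroup.closure_le]
    intro x hx
    obtain ⟨w, i, rfl⟩ := hX hx
    refine MonoidHom.mem_ker.2 ((hε w i).trans (if_neg fun h ↦ hcon _ hx ?_))
    exact (isConj_iff.2 ⟨w, rfl⟩ : IsConj (cs.simple i) _).symm.trans h
  obtain ⟨w, i, rfl⟩ := ht
  have h1 : ε (w * cs.simple i * w⁻¹) = 1 := hker (hgen ▸ Subgroup.mem_top _)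
  rw [hε] at h1
  have h2 : f i = -1 := if_pos (isConj_iff.2 ⟨w, rfl⟩)
  rw [h2] at h1
  exact absurd h1 (by decide)

end SignCharacters

/-! ### From generated roots to the group W -/

section Generation

variable {B W V : Type*} [Group W] {M : CoxeterMatrix B} {cs : CoxeterSystem M W}
  [NormedAddCommGroup V] [InnerProductSpace ℝ V] [FiniteDimensional ℝ V]

omit [FiniteDimensional ℝ V] in
theorem rootReflection_map_eq_conj (g : V ≃ₗᵢ[ℝ] V) (α : V) :
    rootReflection (g α) = g * rootReflection α * g⁻¹ :=
  LinearIsometryEquiv.ext fun v ↦ rootReflection_map g α v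

namespace GeometricRepresentation

variable (ρ : GeometricRepresentation cs V) {R : Set V} {X : Set W}

theorem simpleRoot_mem_roots (i : B) : ρ.simpleRoot i ∈ ρ.roots :=
  ⟨1, i, by rw [map_one]; rfl⟩

theorem rootReflection_mem_map_closure (hR : ρ.IsRootSetOf R X) {γ : V}
    (h : GeneratedRoot R γ) : rootReflection γ ∈ (Subgroup.closure X).map ρ.toHom := by
  have hmem : ∀ α ∈ R, rootReflection α ∈ (Subgroup.closure X).map ρ.toHom := by
    intro α hα
    have : rootReflection α ∈ ρ.toHom '' X := hR.2 ▸ Set.mem_image_of_mem _ hα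
    obtain ⟨x, hx, hxα⟩ := this
    exact ⟨x, Subgroup.subset_closure hx, hxα⟩
  induction h with
  | of_mem hδ => exact hmem _ hδ
  | reflection hδ _ ih =>
    rw [rootReflection_map_eq_conj]
    exact mul_mem (mul_mem (hmem _ hδ) ih) (inv_mem (hmem _ hδ))

theorem generatedRoot_iff_of_mem_closure (hR : ρ.IsRootSetOf R X) {u : W}
    (hu : u ∈ Subgroup.closure X) (γ : V) :
    GeneratedRoot R γ ↔ GeneratedRoot R (ρ.toHom u γ) := by
  induction hu using Subgroup.closure_induction generalizing γ with
  | mem x hx =>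
    have : ρ.toHom x ∈ rootReflection '' R := hR.2 ▸ Set.mem_image_of_mem _ hx
    obtain ⟨α, hα, hαx⟩ := this
    rw [← hαx]
    exact ⟨.reflection hα, (GeneratedRoot.of_mem hα).of_reflection⟩
  | one => rw [map_one]; rfl
  | mul u v _ _ hu hv => rw [map_mul]; exact (hv γ).trans (hu _)
  | inv u _ hu =>
    have : ρ.toHom u (ρ.toHom u⁻¹ γ) = γ := by
      rw [map_inv]
      exact LinearIsometryEquiv.apply_symm_apply _ _
    rw [hu (ρ.toHom u⁻¹ γ), this]

theorem closure_eq_top_iff (hΦ : IsRootSystem ρ.roots) (hX : X ⊆ reflections cs)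
    (hR : ρ.IsRootSetOf R X) :
    Subgroup.closure X = ⊤ ↔ ∀ β ∈ ρ.roots, GeneratedRoot R β := by
  refine ⟨fun hgen β hβ ↦ ?_, fun h ↦ ?_⟩
  · obtain ⟨w, i, hwi⟩ := id hβ
    -- Some x in X is conjugate to the reflection in β. Since X generates, the conjugating element
    -- preserves generated roots and carries the root of x to ±β.
    obtain ⟨x, hx, hconj⟩ := exists_isConj_of_closure_eq_top cs hX hgen
      (t := w * cs.simple i * w⁻¹) ⟨w, i, rfl⟩
    obtain ⟨u, hu⟩ := isConj_iff.1 hconj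
    have : ρ.toHom x ∈ rootReflection '' R := hR.2 ▸ Set.mem_image_of_mem _ hx
    obtain ⟨α, hα, hαx⟩ := this
    have h1 : GeneratedRoot R (ρ.toHom u α) :=
      (ρ.generatedRoot_iff_of_mem_closure hR (hgen ▸ Subgroup.mem_top u) α).1 (.of_mem hα)
    have h2 : rootReflection (ρ.toHom u α) = rootReflection β := by
      rw [hwi, rootReflection_map_eq_conj, rootReflection_map_eq_conj, hαx, ← ρ.map_simple,
        ← map_inv, ← map_inv, ← map_mul, ← map_mul, ← map_mul, ← map_mul, hu]
    rcases hΦ.eq_or_eq_neg_of_rootReflection_eq (hΦ.mem_of_generatedRoot hR.1 h1) hβ h2 with h | h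
    · exact h ▸ h1
    · exact h ▸ h1.neg
  · rw [eq_top_iff, ← cs.subgroup_closure_range_simple, Subgroup.closure_le]
    rintro _ ⟨i, rfl⟩
    obtain ⟨x, hx, hxi⟩ :=
      ρ.rootReflection_mem_map_closure hR (h _ (ρ.simpleRoot_mem_roots i))
    rw [← ρ.map_simple] at hxi
    exact ρ.injective hxi ▸ hx

/-- The generation criterion by the root lattice and the coroot lattice. -/
theorem closure_eq_top_iff_latticeSpan (hΦ : IsRootSystem ρ.roots)
    (hc : IsCrystallographic ρ.roots) (hX : X ⊆ reflections cs) (hR : ρ.IsRootSetOf R X) :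
    Subgroup.closure X = ⊤ ↔ latticeSpan R = latticeSpan ρ.roots ∧
      latticeSpan (coroots R) = latticeSpan (coroots ρ.roots) := by
  rw [ρ.closure_eq_top_iff hΦ hX hR]
  refine ⟨fun h ↦ ⟨le_antisymm (Submodule.span_mono hR.1) (Submodule.span_le.2 fun β hβ ↦
    (h β hβ).mem_latticeSpan hΦ hc hR.1), le_antisymm (Submodule.span_mono (Set.image_mono hR.1))
      (Submodule.span_le.2 ?_)⟩, fun h β hβ ↦ ?_⟩
  · rintro _ ⟨β, hβ, rfl⟩
    exact (h β hβ).coroot_mem_latticeSpan hΦ hc hR.1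
  · refine generatedRoot_of_mem_latticeSpan hΦ hc hR.1 hβ ?_ ?_
    · rw [h.1]
      exact Submodule.subset_span hβ
    · rw [h.2]
      exact Submodule.subset_span (Set.mem_image_of_mem _ hβ)

/-- A subset of `R` is the set of chosen roots of a subset of `X`. -/
theorem IsRootSetOf.of_subset (hR : ρ.IsRootSetOf R X) {R' : Set V} (hR' : R' ⊆ R) :
    ρ.IsRootSetOf R' {x ∈ X | ρ.toHom x ∈ rootReflection '' R'} := by
  refine ⟨hR'.trans hR.1, Set.Subset.antisymm ?_ ?_⟩
  · rintro _ ⟨α, hα, rfl⟩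
    have : rootReflection α ∈ ρ.toHom '' X := hR.2 ▸ Set.mem_image_of_mem _ (hR' hα)
    obtain ⟨x, hx, hxα⟩ := this
    exact ⟨x, ⟨hx, hxα ▸ Set.mem_image_of_mem _ hα⟩, hxα⟩
  · rintro _ ⟨x, hx, rfl⟩
    exact hx.2

theorem isLatticeBasis_of_minimal (hΦ : IsRootSystem ρ.roots) (hc : IsCrystallographic ρ.roots)
    (hR : ρ.IsRootTransversalOf R X) (hmin : Minimal (IsGeneratingReflectionSet cs) X) :
    IsLatticeBasis R (latticeSpan ρ.roots) ∧
      IsLatticeBasis (coroots R) (latticeSpan (coroots ρ.roots)) := by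
  obtain ⟨hX, hgen⟩ := hmin.prop
  obtain ⟨h1, h2⟩ := (ρ.closure_eq_top_iff_latticeSpan hΦ hc hX hR.1).1 hgen
  have hli : LinearIndepOn ℝ id R := by
    refine linearIndepOn_of_irredundant hΦ hc hR.1.1 fun α hα hgenα ↦ ?_
    have hR' := IsRootSetOf.of_subset ρ hR.1 (R' := R \ {α}) Set.sdiff_subset
    have hY : IsGeneratingReflectionSet cs
        {x ∈ X | ρ.toHom x ∈ rootReflection '' (R \ {α})} := by
      refine ⟨fun x hx ↦ hX hx.1, (ρ.closure_eq_top_iff hΦ (fun x hx ↦ hX hx.1) hR').2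
        fun β hβ ↦ ((ρ.closure_eq_top_iff hΦ hX hR.1).1 hgen β hβ).trans fun δ hδ ↦ ?_⟩
      by_cases h : δ = α
      · exact h ▸ hgenα
      · exact .of_mem ⟨hδ, h⟩
    have : rootReflection α ∈ ρ.toHom '' X := hR.1.2 ▸ Set.mem_image_of_mem _ hα
    obtain ⟨x, hx, hxα⟩ := this
    obtain ⟨γ, hγ, hγx⟩ := (hmin.le_of_le hY (fun x hx ↦ hx.1) hx).2
    -- One root per reflection: deleting α really deletes its reflection from X.
    exact hγ.2 (hR.2 hγ.1 hα (hγx.trans hxα))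
  exact ⟨⟨linearIndepOn_int hli, h1⟩,
    linearIndepOn_int (linearIndepOn_coroots hΦ hR.1.1 hli), h2⟩

theorem minimal_of_isLatticeBasis (hΦ : IsRootSystem ρ.roots) (hc : IsCrystallographic ρ.roots)
    (hX : X ⊆ reflections cs) (hR : ρ.IsRootTransversalOf R X)
    (hgen : Subgroup.closure X = ⊤) (hbasis : IsLatticeBasis R (latticeSpan ρ.roots)) :
    Minimal (IsGeneratingReflectionSet cs) X := by
  refine ⟨⟨hX, hgen⟩, fun Y hY hYX x hx ↦ ?_⟩
  have hRY : ρ.IsRootSetOf {α ∈ R | rootReflection α ∈ ρ.toHom '' Y} Y := by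
    refine ⟨fun α hα ↦ hR.1.1 hα.1, Set.Subset.antisymm ?_ ?_⟩
    · rintro _ ⟨α, hα, rfl⟩
      exact hα.2
    · rintro _ ⟨y, hy, rfl⟩
      have : ρ.toHom y ∈ rootReflection '' R := hR.1.2 ▸ Set.mem_image_of_mem _ (hYX hy)
      obtain ⟨α, hα, hαy⟩ := this
      exact ⟨α, ⟨hα, hαy ▸ Set.mem_image_of_mem _ hy⟩, hαy⟩
  have h1 := ((ρ.closure_eq_top_iff_latticeSpan hΦ hc hY.1 hRY).1 hY.2).1
  have : ρ.toHom x ∈ rootReflection '' R := hR.1.2 ▸ Set.mem_image_of_mem _ hx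
  obtain ⟨α, hα, hαx⟩ := this
  have hαY : rootReflection α ∈ ρ.toHom '' Y := by
    by_contra hα'
    -- A proper generating subset would put the omitted basis vector α in the span of the remaining
    -- ones.
    refine LinearIndependent.notMem_span_image hbasis.1 (x := ⟨α, hα⟩)
      (s := {δ | rootReflection (δ : V) ∈ ρ.toHom '' Y}) hα' ?_
    have h2 : (fun δ : R ↦ id (δ : V)) '' {δ | rootReflection (δ : V) ∈ ρ.toHom '' Y} =
        {α ∈ R | rootReflection α ∈ ρ.toHom '' Y} := by
      ext δ
      exact ⟨by rintro ⟨δ, hδ, rfl⟩; exact ⟨δ.2, hδ⟩, fun hδ ↦ ⟨⟨δ, hδ.1⟩, hδ.2, rfl⟩⟩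
    rw [h2]
    exact h1.ge (Submodule.subset_span (hR.1.1 hα))
  obtain ⟨y, hy, hyx⟩ := hαY
  exact ρ.injective (hyx.trans hαx) ▸ hy

end GeometricRepresentation

end Generation

end ReflectionGeneration

open ReflectionGeneration in
theorem mainTheorem2 {B W V : Type*} [Group W] [Finite W] {M : CoxeterMatrix B}
    (cs : CoxeterSystem M W)
    [NormedAddCommGroup V] [InnerProductSpace ℝ V] [FiniteDimensional ℝ V]
    (ρ : GeometricRepresentation cs V)
    (hΦ : IsRootSystem ρ.roots) (hcrys : IsCrystallographic ρ.roots)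
    (X : Set W) (hX : X ⊆ reflections cs) :
    (∀ R : Set V, ρ.IsRootSetOf R X →
      (Subgroup.closure X = ⊤ ↔
        latticeSpan R = latticeSpan ρ.roots ∧
          latticeSpan (coroots R) = latticeSpan (coroots ρ.roots))) ∧
    (∀ R : Set V, ρ.IsRootTransversalOf R X → Subgroup.closure X = ⊤ →
      (Minimal (IsGeneratingReflectionSet cs) X ↔
        IsLatticeBasis R (latticeSpan ρ.roots) ∧
          IsLatticeBasis (coroots R) (latticeSpan (coroots ρ.roots)))) := by
  refine ⟨fun R hR ↦ ρ.closure_eq_top_iff_latticeSpan hΦ hcrys hX hR, fun R hR hgen ↦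
    ⟨ρ.isLatticeBasis_of_minimal hΦ hcrys hR, fun h ↦
      ρ.minimal_of_isLatticeBasis hΦ hcrys hX hR hgen h.1⟩⟩
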